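/- Let $\mathcal Z$ be a complex Hilbert space, let $A:D(A)\subset\mathcal Z\to\mathcal Z$ be a self-adjoint operator that generates a $C_0$-semigroup and whose spectrum $\sigma(A)$ is nonempty, has no finite accumulation point and consists of eigenvalues of finite algebraic multiplicity. Let $B:\mathbb C\to\mathcal Z$ be a nonzero bounded linear operator and consider the collocated self-adjoint system $\Sigma(A,B,B^*)$. Its invariant zeros are the $s\in\mathbb C$ for which there are $0\neq x\in D(A)$ and $u\in\mathbb C$ with $(sI-A)x=Bu$ and $B^*x=0$; its transmission zeros are the $s\in\rho(A)$ with $B^*(sI-A)^{-1}B=0$. Suppose that the system is minimal, that is, no invariant zero lies in $\sigma(A)$. By the root-locus branches we mean a family $(f_n)$ of continuous functions $f_n:[0,\infty)\to\mathbb C$ such that for every $k\ge 0$ the values $f_n(k)$ list the eigenvalues of $A-kBB^*$, each repeated according to its algebraic multiplicity. Then: 1. A family of root-locus branches exists, with exactly one branch starting at each eigenvalue of $A$. 2. The eigenvalues of $A$ are real. The invariant zeros and the transmission zeros coincide; they are real and interlace with the eigenvalues: no zero is an eigenvalue, every zero lies strictly between two eigenvalues, strictly between any two distinct eigenvalues there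 is a zero, and strictly between any two distinct zeros there is an eigenvalue. 3. Each branch $f_n$ of each such family is real-valued and strictly decreasing on $[0,\infty)$, and it is differentiable there (one-sidedly at $k=0$) with $$f_n'(k)=-|B^*x|^2$$ for every $k\ge0$ and every $x\in D(A)$ with $\|x\|=1$ and $(A-kBB^*)x=f_n(k)x$. 4. If $\mathcal Z$ is infinite-dimensional, then each branch $f_n(k)$ converges, as $k\to\infty$, to a zero of the system; in particular no branch satisfies $|f_n(k)|\to\infty$, so the root locus has no asymptote. -/

import Mathlib

open Set Filter Topology
open scoped NNReal

universe u v

noncomputable section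

section Operators

variable {Z : Type u} [NormedAddCommGroup Z] [InnerProductSpace ℂ Z]

/-- A strongly continuous one-parameter semigroup of bounded operators on `Z`. -/
structure IsC0Semigroup (T : ℝ≥0 → Z →L[ℂ] Z) : Prop where
  map_zero : T 0 = ContinuousLinearMap.id ℂ Z
  map_add : ∀ s t, T (s + t) = (T s).comp (T t)
  continuous : ∀ z, Continuous fun t => T t z

/-- `A` is the infinitesimal generator of `T`: `x ∈ D(A)` and `A x = y` exactly when the difference
quotients `(T t x - x) / t` converge to `y` as `t ↓ 0`. -/
def IsGenerator (A : Z →ₗ.[ℂ] Z) (T : ℝ≥0 → Z →L[ℂ] Z) : Prop :=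
  ∀ x y : Z, (x, y) ∈ A.graph ↔
    Tendsto (fun t : ℝ≥0 => (((t : ℝ) : ℂ)⁻¹) • (T t x - x)) (𝓝[>] 0) (𝓝 y)

/-- `R` is the bounded two-sided inverse of `s I - A : D(A) → Z`. -/
def IsResolventAt (A : Z →ₗ.[ℂ] Z) (s : ℂ) (R : Z →L[ℂ] Z) : Prop :=
  (∀ y : Z, ∃ h : R y ∈ A.domain, s • R y - A ⟨R y, h⟩ = y) ∧
    ∀ x : A.domain, R (s • (x : Z) - A x) = x

/-- The resolvent set `ρ(A)`. -/
def resolventSetOf (A : Z →ₗ.[ℂ] Z) : Set ℂ := {s | ∃ R : Z →L[ℂ] Z, IsResolventAt A s R}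

/-- The spectrum `σ(A)`. -/
def spectrumOf (A : Z →ₗ.[ℂ] Z) : Set ℂ := (resolventSetOf A)ᶜ

open Classical in
/-- The resolvent `(s I - A)⁻¹` for `s ∈ ρ(A)` (and `0` otherwise). -/
def resolventOf (A : Z →ₗ.[ℂ] Z) (s : ℂ) : Z →L[ℂ] Z :=
  if h : ∃ R : Z →L[ℂ] Z, IsResolventAt A s R then h.choose else 0

/-- `s` is an eigenvalue of `A`. -/
def IsEigenvalueOf (A : Z →ₗ.[ℂ] Z) (s : ℂ) : Prop :=
  ∃ x : A.domain, (x : Z) ≠ 0 ∧ A x = s • (x : Z)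

/-- The kernel of `(s I - A) ^ m`, where `D((s I - A) ^ (m + 1))` consists of the `x ∈ D(A)` with
`(s I - A) x ∈ D((s I - A) ^ m)`. -/
def kerPow (A : Z →ₗ.[ℂ] Z) (s : ℂ) : ℕ → Submodule ℂ Z
  | 0 => ⊥
  | m + 1 => ((kerPow A s m).comap (s • A.domain.subtype - A.toFun)).map A.domain.subtype

/-- The generalized eigenspace `⋃ₘ ker (s I - A) ^ m` (an increasing union). -/
def rootSpace (A : Z →ₗ.[ℂ] Z) (s : ℂ) : Submodule ℂ Z := ⨆ m, kerPow A s m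

/-- The algebraic multiplicity of `s` as an eigenvalue of `A` (`0` if `s` is not an eigenvalue). -/
def algMultiplicity (A : Z →ₗ.[ℂ] Z) (s : ℂ) : ℕ∞ :=
  Cardinal.toENat (Module.rank ℂ (rootSpace A s))

/-- `σ(A)` is nonempty, has no finite accumulation point, and consists of eigenvalues of finite
algebraic multiplicity. -/
structure HasDiscreteSpectrum (A : Z →ₗ.[ℂ] Z) : Prop where
  nonempty : (spectrumOf A).Nonempty
  no_accPt : ∀ s : ℂ, ¬ AccPt s (𝓟 (spectrumOf A))
  eigenvalue : ∀ s ∈ spectrumOf A, IsEigenvalueOf A s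
  finite_mult : ∀ s ∈ spectrumOf A, algMultiplicity A s ≠ ⊤

end Operators

/-- The data of a single-input single-output system `Σ(A, B, C)` on `Z` (with zero feedthrough):
`x' = A x + B u`, `y = C x`. -/
structure SISOSystem (Z : Type u) [NormedAddCommGroup Z] [InnerProductSpace ℂ Z] where
  A : Z →ₗ.[ℂ] Z
  B : ℂ →L[ℂ] Z
  C : Z →L[ℂ] ℂ

namespace SISOSystem

variable {Z : Type u} [NormedAddCommGroup Z] [InnerProductSpace ℂ Z]

/-- The standing assumptions on a system: `A` generates a `C₀`-semigroup, `B` and `C` do not vanish,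
and `σ(A)` is nonempty and consists of isolated eigenvalues of finite algebraic multiplicity. -/
structure StandingAssumptions (S : SISOSystem Z) : Prop where
  generates : ∃ T : ℝ≥0 → Z →L[ℂ] Z, IsC0Semigroup T ∧ IsGenerator S.A T
  B_ne_zero : S.B ≠ 0
  C_ne_zero : S.C ≠ 0
  discrete : HasDiscreteSpectrum S.A

/-- The transfer function `G(s) = C (s I - A)⁻¹ B`, `s ∈ ρ(A)`. -/
def transferFunction (S : SISOSystem Z) (s : ℂ) : ℂ := S.C (resolventOf S.A s (S.B 1))

/-- The transmission zeros: the zeros of the transfer function in `ρ(A)`. -/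
def transmissionZeros (S : SISOSystem Z) : Set ℂ :=
  {s | s ∈ resolventSetOf S.A ∧ S.transferFunction s = 0}

/-- The invariant zeros: those `s` for which `(s I - A) x - B u = 0`, `C x = 0` has a solution with
`0 ≠ x ∈ D(A)` and `u` a scalar. -/
def invariantZeros (S : SISOSystem Z) : Set ℂ :=
  {s | ∃ (x : S.A.domain) (w : ℂ), (x : Z) ≠ 0 ∧ s • (x : Z) - S.A x - S.B w = 0 ∧ S.C x = 0}

/-- Minimality: no invariant zero lies in `σ(A)`. -/
def IsMinimal (S : SISOSystem Z) : Prop := S.invariantZeros ∩ spectrumOf S.A = ∅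

/-- The closed-loop operator `A - k B C` with domain `D(A)`. -/
def closedLoop (S : SISOSystem Z) (k : ℝ) : Z →ₗ.[ℂ] Z where
  domain := S.A.domain
  toFun := S.A.toFun - (k : ℂ) • ((S.B.comp S.C : Z →L[ℂ] Z) : Z →ₗ[ℂ] Z).comp S.A.domain.subtype

/-- `Σ(A, B, C)` is collocated self-adjoint: `A` is self-adjoint and `C = B*`. -/
def IsCollocatedSelfAdjoint [CompleteSpace Z] (S : SISOSystem Z) : Prop :=
  IsSelfAdjoint S.A ∧ S.C = ContinuousLinearMap.adjoint S.B

/-- `(f n)` is the family of root-locus branches: continuous curves on `[0, ∞)` such that, for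
every `k ≥ 0`, the values `f n k` list the eigenvalues of `A - k B C`, each as often as its
algebraic multiplicity. In particular the starting points `f n 0` list the eigenvalues of `A`. -/
structure IsRootLocus (S : SISOSystem Z) {ι : Type v} (f : ι → ℝ → ℂ) : Prop where
  continuousOn : ∀ n, ContinuousOn (f n) (Ici 0)
  encard_eq : ∀ k : ℝ, 0 ≤ k → ∀ s : ℂ, {n | f n k = s}.encard = algMultiplicity (S.closedLoop k) s

end SISOSystem

/-- The points of `M` interlace with those of `P` on the real line: the sets are disjoint, every
point of `M` lies strictly between two points of `P`, between any two points of `P` there is a point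
of `M`, and between any two points of `M` there is a point of `P`. -/
structure Interlace (M P : Set ℝ) : Prop where
  disjoint : Disjoint M P
  between : ∀ z ∈ M, ∃ p ∈ P, ∃ q ∈ P, p < z ∧ z < q
  exists_left : ∀ p ∈ P, ∀ q ∈ P, p < q → ∃ z ∈ M, p < z ∧ z < q
  exists_right : ∀ z ∈ M, ∀ w ∈ M, z < w → ∃ p ∈ P, z < p ∧ p < w

end

/-!
Write `b = B 1`, so that `C x = B* x = ⟪b, x⟫`. Minimality says that the functional `B*` vanishes on
no eigenvector of `A`; hence all eigenvalues of `A` are simple. The eigenvectors are complete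
(`eq_zero_of_orthogonal_eigenvectors`): for a real point `μ` of the resolvent set,
`R = (μ - A)⁻¹` is a bounded self-adjoint operator with isolated nonzero spectral points, and its
continuous functional calculus provides the spectral projections. So there is an orthonormal basis
of eigenvectors `φ l`, one for each eigenvalue `p l`
(`SISOSystem.exists_isModalBasis`).

In this basis the transfer function on the real line is the sum of simple poles
`G s = ∑ β l / (s - p l)` with `β l = |⟪b, φ l⟫|² > 0`. The closed-loop operator `A - k B B*` is
symmetric, so that its root spaces are eigenspaces, and by minimality these have dimension at most
one. For `k > 0` its eigenvalues are the real solutions of `1 + k G s = 0`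
(`SISOSystem.IsModalBasis.isEigenvalueOf_closedLoop_iff`), and the zeros of the system are the zeros
of `G`. Since `G` decreases strictly between consecutive poles, zeros and poles interlace.

The root locus is read off from the inverse point of view: the gain `k = -1 / G s`, extended by `0`
to the poles, is a differentiable function of the eigenvalue `s` with negative derivative, also at
the poles. To the left of each pole `p n` it maps the interval down to the next zero (or to `-∞`),
the `stem` of `p n`, bijectively onto `[0, ∞)`. Its inverse is the branch starting at `p n`.
Any continuous selection of closed-loop eigenvalues stays in one stem, is a right inverse of the
gain, and so inherits its derivative; for a normalized eigenvector `x` that derivative is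
`-|B* x|²` because the gain has derivative `-1 / |B* x|²`
(`SISOSystem.IsModalBasis.hasDerivAt_gain`).

A branch tends to the zero at the end of its stem as soon as there is a pole further to the left.
The generator property bounds the eigenvalues above (`IsGenerator.eigenvalue_le`), and in infinite
dimensions there are infinitely many of them without accumulation point, so they are unbounded
below and every branch has such a pole.
-/

/-! ### Sums of simple poles on the real line -/

/-- Poles `p n` with positive weights `β n` of finite total mass; `separated` says that the poles do
not accumulate at any real point. -/
structure SeparatedPoles {ι : Type*} (p β : ι → ℝ) : Prop where
  injective : Function.Injective p
  separated : ∀ s, ∃ δ > 0, ∀ n, p n ≠ s → δ ≤ |s - p n|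
  pos : ∀ n, 0 < β n
  summable : Summable β

/-- The sum of simple poles `∑ β n / (s - p n)`. At a pole `s = p n` the convention `β n / 0 = 0`
makes it the sum over the remaining poles. -/
noncomputable def poleSum {ι : Type*} (p β : ι → ℝ) (s : ℝ) : ℝ := ∑' n, β n / (s - p n)

open Classical in
/-- The gain `k` for which `s` solves `1 + k * poleSum p β s = 0`, extended by its limit `0` to the
poles. At a zero of `poleSum p β`, where the gain blows up, it takes the junk value `0`. -/
noncomputable def gain {ι : Type*} (p β : ι → ℝ) (s : ℝ) : ℝ :=
  if s ∈ range p then 0 else -(poleSum p β s)⁻¹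

section PoleSum

variable {ι : Type*} {p β : ι → ℝ}

/-- Bound for the terms of the sum, and of its derivative, in terms of the distance to the poles. -/
lemma norm_div_pow_le {b x δ : ℝ} (hb : 0 ≤ b) (hδ : 0 < δ) (h : b ≠ 0 → δ ≤ |x|) (m : ℕ) :
    ‖b / x ^ m‖ ≤ b / δ ^ m := by
  rw [norm_div, norm_pow, Real.norm_eq_abs, Real.norm_eq_abs, abs_of_nonneg hb]
  rcases eq_or_ne b 0 with rfl | hb0
  · simp
  · have := h hb0
    gcongr

lemma summable_div_pow (hsep : ∀ s, ∃ δ > 0, ∀ n, p n ≠ s → δ ≤ |s - p n|) (hβ : ∀ n, 0 ≤ β n)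
    (hsum : Summable β) (s : ℝ) {m : ℕ} (hm : m ≠ 0) :
    Summable fun n => β n / (s - p n) ^ m := by
  obtain ⟨δ, hδ, h⟩ := hsep s
  refine Summable.of_norm_bounded (hsum.div_const (δ ^ m)) fun n => ?_
  rcases eq_or_ne (p n) s with hs | hs
  · simp only [hs, sub_self, zero_pow hm, div_zero, norm_zero]
    exact div_nonneg (hβ n) (by positivity)
  · exact norm_div_pow_le (hβ n) hδ (fun _ => h n hs) m

/-- Termwise differentiation of the sum. A pole of weight `0` at `s` is allowed, so that the lemma
also covers the regular part of the sum at one of its poles. -/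
lemma hasDerivAt_poleSum (hsep : ∀ s, ∃ δ > 0, ∀ n, p n ≠ s → δ ≤ |s - p n|)
    (hβ : ∀ n, 0 ≤ β n) (hsum : Summable β) {s : ℝ} (hs : ∀ n, p n = s → β n = 0) :
    HasDerivAt (poleSum p β) (-∑' n, β n / (s - p n) ^ 2) s := by
  obtain ⟨δ, hδ, h⟩ := hsep s
  have hfar : ∀ n, ∀ y ∈ Metric.ball s (δ / 2), β n ≠ 0 → δ / 2 ≤ |y - p n| := by
    intro n y hy hn
    have h1 := h n fun e => hn (hs n e)
    rw [Metric.mem_ball, Real.dist_eq, abs_sub_comm] at hy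
    have h2 := abs_sub_le s y (p n)
    linarith
  have key := hasDerivAt_tsum_of_isPreconnected (𝕜 := ℝ) (t := Metric.ball s (δ / 2)) (y₀ := s)
    (y := s) (g := fun n y => β n / (y - p n)) (g' := fun n y => -(β n / (y - p n) ^ 2))
    (hsum.div_const ((δ / 2) ^ 2)) Metric.isOpen_ball (convex_ball s _).isPreconnected
    (fun n y hy => by
      rcases eq_or_ne (β n) 0 with h0 | h0
      · simpa [h0] using hasDerivAt_const y (0 : ℝ)
      · have h1 : y - p n ≠ 0 := by
          intro e
          have h2 := hfar n y hy h0
          rw [e, abs_zero] at h2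
          linarith
        have h2 := ((hasDerivAt_id y).sub_const (p n)).fun_inv h1 |>.const_mul (β n)
        simp only [id] at h2
        refine h2.congr_deriv ?_
        ring)
    (fun n y hy => by
      rw [norm_neg]
      exact norm_div_pow_le (hβ n) (half_pos hδ) (hfar n y hy) 2)
    (Metric.mem_ball_self (half_pos hδ))
    (by simpa using summable_div_pow hsep hβ hsum s one_ne_zero)
    (Metric.mem_ball_self (half_pos hδ))
  rw [tsum_neg] at key
  exact key

lemma gain_pole (n : ι) : gain p β (p n) = 0 := if_pos ⟨n, rfl⟩

lemma gain_of_notMem {s : ℝ} (hs : s ∉ range p) : gain p β s = -(poleSum p β s)⁻¹ := if_neg hs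

end PoleSum

namespace SeparatedPoles

variable {ι : Type*} {p β : ι → ℝ} (H : SeparatedPoles p β)
include H

lemma summable_div (s : ℝ) : Summable fun n => β n / (s - p n) := by
  simpa using summable_div_pow H.separated (fun n => (H.pos n).le) H.summable s one_ne_zero

lemma hasDerivAt {s : ℝ} (hs : s ∉ range p) :
    HasDerivAt (poleSum p β) (-∑' n, β n / (s - p n) ^ 2) s :=
  hasDerivAt_poleSum H.separated (fun n => (H.pos n).le) H.summable
    fun n hn => (hs ⟨n, hn⟩).elim

lemma tsum_sq_pos [Nonempty ι] {s : ℝ} (hs : s ∉ range p) : 0 < ∑' n, β n / (s - p n) ^ 2 := by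
  have hpos : ∀ n, 0 < β n / (s - p n) ^ 2 := fun n =>
    div_pos (H.pos n) (sq_pos_of_ne_zero (sub_ne_zero.2 fun e => hs ⟨n, e.symm⟩))
  exact (summable_div_pow H.separated (fun n => (H.pos n).le) H.summable s two_ne_zero).tsum_pos
    (fun n => (hpos n).le) (Classical.arbitrary ι) (hpos _)

lemma eventually_ne (s : ℝ) : ∀ᶠ t in 𝓝 s, t ≠ s → t ∉ range p := by
  obtain ⟨δ, hδ, h⟩ := H.separated s
  filter_upwards [Metric.ball_mem_nhds s hδ] with t ht hts
  rintro ⟨n, rfl⟩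
  have := h n hts
  rw [Metric.mem_ball, Real.dist_eq, abs_sub_comm] at ht
  linarith

lemma eventually_notMem {s : ℝ} (hs : s ∉ range p) : ∀ᶠ t in 𝓝 s, t ∉ range p := by
  filter_upwards [H.eventually_ne s] with t ht
  by_cases hts : t = s
  · rwa [hts]
  · exact ht hts

lemma strictAntiOn [Nonempty ι] {D : Set ℝ} (hD : D.OrdConnected) (h : ∀ s ∈ D, s ∉ range p) :
    StrictAntiOn (poleSum p β) D := by
  refine strictAntiOn_of_deriv_neg hD.convex
    (fun s hs => (H.hasDerivAt (h s hs)).continuousAt.continuousWithinAt) fun s hs => ?_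
  have hs' := h s (interior_subset hs)
  rw [(H.hasDerivAt hs').deriv, neg_lt_zero]
  exact H.tsum_sq_pos hs'

lemma poleSum_pos [Nonempty ι] {s : ℝ} (hs : ∀ n, p n < s) : 0 < poleSum p β s :=
  (H.summable_div s).tsum_pos (fun n => (div_pos (H.pos n) (sub_pos.2 (hs n))).le)
    (Classical.arbitrary ι) (div_pos (H.pos _) (sub_pos.2 (hs _)))

lemma poleSum_neg [Nonempty ι] {s : ℝ} (hs : ∀ n, s < p n) : poleSum p β s < 0 := by
  have hpos : ∀ n, 0 < β n / (p n - s) := fun n => div_pos (H.pos n) (sub_pos.2 (hs n))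
  have heq : ∀ n, -(β n / (s - p n)) = β n / (p n - s) := fun n => by
    rw [← div_neg, neg_sub]
  have h := (H.summable_div s).neg.tsum_pos (fun n => (heq n ▸ hpos n).le)
    (Classical.arbitrary ι) (heq _ ▸ hpos _)
  rw [tsum_neg] at h
  exact neg_pos.1 h

/-! ### The gain as a function of the closed-loop eigenvalue -/

lemma hasDerivAt_gain {s : ℝ} (hs : s ∉ range p) (h0 : poleSum p β s ≠ 0) :
    HasDerivAt (gain p β) (-(∑' n, β n / (s - p n) ^ 2) / poleSum p β s ^ 2) s := by
  have h := ((H.hasDerivAt hs).fun_inv h0).fun_neg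
  refine HasDerivAt.congr_of_eventuallyEq (h.congr_deriv (by ring)) ?_
  filter_upwards [H.eventually_notMem hs] with t ht
  exact gain_of_notMem ht

/-- At a pole, the gain has the derivative `-1 / β n`: writing the sum as `β n / (t - p n) + r t`
with the regular part `r`, the gain is `-(t - p n) / (β n + (t - p n) * r t)` near `p n`. -/
lemma hasDerivAt_gain_pole (n : ι) : HasDerivAt (gain p β) (-(β n)⁻¹) (p n) := by
  classical
  set β' := Function.update β n 0 with hβ'
  have hβ'0 : ∀ m, 0 ≤ β' m := fun m => by
    rcases eq_or_ne m n with rfl | hm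
    · simp [hβ']
    · simpa [hβ', hm] using (H.pos m).le
  have hr := hasDerivAt_poleSum (p := p) (β := β') (s := p n) H.separated hβ'0
    (H.summable.update n 0) (fun m hm => by rw [H.injective hm]; simp [hβ'])
  have hsplit : ∀ t, poleSum p β t = β n / (t - p n) + poleSum p β' t := fun t => by
    rw [poleSum, (H.summable_div t).tsum_eq_add_tsum_ite n, poleSum]
    congr 1
    refine tsum_congr fun m => ?_
    rcases eq_or_ne m n with rfl | hm
    · simp [hβ']
    · simp [hβ', hm]
  have hid := (hasDerivAt_id (p n)).sub_const (p n)
  have hden := (hid.fun_mul hr).const_add (β n)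
  have hn := (H.pos n).ne'
  have h := (hid.fun_div hden (by simpa using hn)).fun_neg
  refine HasDerivAt.congr_of_eventuallyEq (h.congr_deriv ?_) ?_
  · simp only [id, sub_self, zero_mul, add_zero, one_mul, sub_zero]
    field_simp
  · filter_upwards [H.eventually_ne (p n)] with t ht
    rcases eq_or_ne t (p n) with rfl | htn
    · simp [gain_pole]
    · rw [gain_of_notMem (ht htn), hsplit]
      have : t - p n ≠ 0 := sub_ne_zero.2 htn
      simp only [id]
      rw [div_add' _ _ _ this, inv_div, mul_comm (t - p n)]

/-- Crossing a pole to the right, the gain changes sign from plus to minus. -/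
lemma eventually_gain_mul_neg (n : ι) :
    ∀ᶠ t in 𝓝[≠] p n, t ∉ range p ∧ gain p β t * (t - p n) < 0 := by
  have h := hasDerivAt_iff_tendsto_slope.1 (H.hasDerivAt_gain_pole n)
  have hneg : -(β n)⁻¹ < 0 := neg_lt_zero.2 (inv_pos.2 (H.pos n))
  filter_upwards [h.eventually (gt_mem_nhds hneg), self_mem_nhdsWithin,
    (H.eventually_ne (p n)).filter_mono nhdsWithin_le_nhds] with t ht htn hr
  refine ⟨hr htn, ?_⟩
  have h2 : 0 < (t - p n) ^ 2 := sq_pos_of_ne_zero (sub_ne_zero.2 htn)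
  have h3 : t - p n ≠ 0 := sub_ne_zero.2 htn
  rw [slope_def_field, gain_pole, sub_zero] at ht
  have h4 : gain p β t * (t - p n) = gain p β t / (t - p n) * (t - p n) ^ 2 := by
    field_simp
  rw [h4]
  exact mul_neg_of_neg_of_pos ht h2

end SeparatedPoles

/-! ### Stems: where the branches run -/

/-- The part of the real line swept by the root-locus branch that starts at the pole `p n`: the
points `s ≤ p n` such that the sum is negative and has no pole on `[s, p n)`. -/
def stem {ι : Type*} (p β : ι → ℝ) (n : ι) : Set ℝ :=
  {s | s ≤ p n ∧ ∀ t, s ≤ t → t < p n → t ∉ range p ∧ poleSum p β t < 0}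

/-- The solutions `s` of `1 + k * poleSum p β s = 0` for `k > 0`, and the poles for `k = 0`. -/
def closedLoopPoints {ι : Type*} (p β : ι → ℝ) (k : ℝ) : Set ℝ :=
  {s | (k = 0 ∧ s ∈ range p) ∨ (0 < k ∧ s ∉ range p ∧ k * poleSum p β s = -1)}

section Stem

variable {ι : Type*} {p β : ι → ℝ} {n : ι} {s : ℝ}

lemma pole_mem_stem (n : ι) : p n ∈ stem p β n := ⟨le_rfl, fun _ h h' => (h.not_gt h').elim⟩

lemma mem_stem_of_le {t : ℝ} (hs : s ∈ stem p β n) (hst : s ≤ t) (ht : t ≤ p n) :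
    t ∈ stem p β n :=
  ⟨ht, fun r hr => hs.2 r (hst.trans hr)⟩

lemma ordConnected_stem : (stem p β n).OrdConnected :=
  ⟨fun _ ha _ hb _ hc => mem_stem_of_le ha hc.1 (hc.2.trans hb.1)⟩

lemma neg_of_mem_stem (hs : s ∈ stem p β n) (hne : s ≠ p n) :
    s ∉ range p ∧ poleSum p β s < 0 :=
  hs.2 s le_rfl (lt_of_le_of_ne hs.1 hne)

lemma gain_pos_of_mem_stem (hs : s ∈ stem p β n) (hne : s ≠ p n) : 0 < gain p β s := by
  obtain ⟨h1, h2⟩ := neg_of_mem_stem hs hne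
  rw [gain_of_notMem h1, neg_pos]
  exact inv_lt_zero.2 h2

lemma gain_nonneg_of_mem_stem (hs : s ∈ stem p β n) : 0 ≤ gain p β s := by
  by_cases h : s = p n
  · rw [h, gain_pole]
  · exact (gain_pos_of_mem_stem hs h).le

lemma gain_eq_of_mem {k : ℝ} (h : s ∈ closedLoopPoints p β k) : gain p β s = k := by
  rcases h with ⟨rfl, n, rfl⟩ | ⟨hk, hs, h⟩
  · exact gain_pole n
  · rw [gain_of_notMem hs, neg_inv]
    exact inv_eq_of_mul_eq_one_left (by linarith)

lemma poleSum_neg_of_mem {k : ℝ} (h : s ∈ closedLoopPoints p β k) (hk : 0 < k) :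
    s ∉ range p ∧ poleSum p β s < 0 := by
  rcases h with ⟨rfl, _⟩ | ⟨_, hs, h⟩
  · exact (lt_irrefl _ hk).elim
  · exact ⟨hs, neg_of_mul_neg_right (h ▸ neg_one_lt_zero) hk.le⟩

lemma mem_closedLoopPoints_gain (hs : s ∈ stem p β n) : s ∈ closedLoopPoints p β (gain p β s) := by
  by_cases h : s = p n
  · exact Or.inl ⟨by rw [h, gain_pole], n, h.symm⟩
  · obtain ⟨h1, h2⟩ := neg_of_mem_stem hs h
    refine Or.inr ⟨gain_pos_of_mem_stem hs h, h1, ?_⟩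
    rw [gain_of_notMem h1, neg_mul, inv_mul_cancel₀ h2.ne]

lemma eq_of_mem_stem {m : ι} (hp : Function.Injective p) (hn : s ∈ stem p β n)
    (hm : s ∈ stem p β m) : n = m := by
  by_contra hne
  rcases lt_or_gt_of_ne (hp.ne hne) with h | h
  · exact (hm.2 (p n) hn.1 h).1 ⟨n, rfl⟩
  · exact (hn.2 (p m) hm.1 h).1 ⟨m, rfl⟩

lemma exists_start {f : ℝ → ℝ} (hmem : ∀ k, 0 ≤ k → f k ∈ closedLoopPoints p β k) :
    ∃ n, f 0 = p n := by
  rcases hmem 0 le_rfl with ⟨-, n, hn⟩ | ⟨h, -⟩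
  · exact ⟨n, hn.symm⟩
  · exact (lt_irrefl _ h).elim

/-- A selection is a right inverse of the gain, so its derivative is the reciprocal one. -/
lemma selection_hasDerivWithinAt {f : ℝ → ℝ} (hf : ContinuousOn f (Ici 0))
    (hmem : ∀ k, 0 ≤ k → f k ∈ closedLoopPoints p β k) {k d : ℝ} (hk : 0 ≤ k)
    (hd : HasDerivAt (gain p β) d (f k))
    (hd0 : d ≠ 0) : HasDerivWithinAt f d⁻¹ (Ici 0) k := by
  have h : HasFDerivAt (gain p β)
      (ContinuousLinearEquiv.unitsEquivAut ℝ (Units.mk0 d hd0) : ℝ →L[ℝ] ℝ) (f k) := hd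
  exact HasFDerivWithinAt.of_local_left_inverse (t := univ) (by rw [nhdsWithin_univ]; exact hf k hk)
    h.hasFDerivWithinAt hk (eventually_mem_nhdsWithin.mono fun l hl => gain_eq_of_mem (hmem l hl))

end Stem

namespace SeparatedPoles

variable {ι : Type*} {p β : ι → ℝ} (H : SeparatedPoles p β)
include H

/-- A point where the sum is negative lies on the stem of the next pole to its right; there is such a
pole because the sum is positive to the right of all poles. -/
lemma exists_mem_stem (s : ℝ) (hs : s ∉ range p) (h0 : poleSum p β s < 0) :
    ∃ n, s ∈ stem p β n := by
  have hne : Nonempty ι := by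
    by_contra hι
    rw [not_nonempty_iff] at hι
    simp [poleSum] at h0
  -- the next pole to the right of `s` is the infimum of the poles to the right of `s`
  set Q : Set ℝ := {x | x ∈ range p ∧ s < x} with hQ
  have hQne : Q.Nonempty := by
    by_contra hemp
    refine h0.not_gt (H.poleSum_pos fun n => ?_)
    by_contra hn
    exact hemp ⟨p n, ⟨n, rfl⟩, lt_of_le_of_ne (not_lt.1 hn) fun e => hs ⟨n, e.symm⟩⟩
  have hQb : BddBelow Q := ⟨s, fun x hx => hx.2.le⟩
  have hmem : sInf Q ∈ Q := by
    obtain ⟨δ, hδ, h⟩ := H.separated (sInf Q)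
    obtain ⟨x, hx, hlt⟩ := exists_lt_of_csInf_lt hQne (lt_add_of_pos_right (sInf Q) hδ)
    obtain ⟨⟨m, rfl⟩, hsm⟩ := hx
    have hle := csInf_le hQb (show p m ∈ Q from ⟨⟨m, rfl⟩, hsm⟩)
    by_cases e : p m = sInf Q
    · rw [← e]
      exact ⟨⟨m, rfl⟩, hsm⟩
    · have := h m e
      rw [abs_sub_comm, abs_of_nonneg (sub_nonneg.2 hle)] at this
      linarith
  obtain ⟨⟨n, hn⟩, hlt⟩ := hmem
  have hfree : ∀ t, s ≤ t → t < p n → t ∉ range p := by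
    intro t hst htn ht
    rcases hst.eq_or_lt with rfl | hst
    · exact hs ht
    · exact (csInf_le hQb (show t ∈ Q from ⟨ht, hst⟩)).not_gt (hn ▸ htn)
  refine ⟨n, hn ▸ hlt.le, fun t hst htn => ⟨hfree t hst htn, ?_⟩⟩
  have hanti := H.strictAntiOn (D := Icc s t) ordConnected_Icc
    fun r hr => hfree r hr.1 (hr.2.trans_lt htn)
  exact (hanti.antitoneOn (left_mem_Icc.2 hst) (right_mem_Icc.2 hst) hst).trans_lt h0

lemma exists_hasDerivAt_gain {n : ι} {s : ℝ} (hs : s ∈ stem p β n) :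
    ∃ d < 0, HasDerivAt (gain p β) d s := by
  have : Nonempty ι := ⟨n⟩
  by_cases h : s = p n
  · subst h
    exact ⟨_, neg_lt_zero.2 (inv_pos.2 (H.pos n)), H.hasDerivAt_gain_pole n⟩
  · obtain ⟨h1, h2⟩ := neg_of_mem_stem hs h
    exact ⟨_, div_neg_of_neg_of_pos (neg_lt_zero.2 (H.tsum_sq_pos h1)) (sq_pos_of_ne_zero h2.ne),
      H.hasDerivAt_gain h1 h2.ne⟩

lemma continuousOn_gain (n : ι) : ContinuousOn (gain p β) (stem p β n) := fun _ hs =>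
  let ⟨_, _, h⟩ := H.exists_hasDerivAt_gain hs
  h.continuousAt.continuousWithinAt

lemma strictAntiOn_gain (n : ι) : StrictAntiOn (gain p β) (stem p β n) := by
  refine strictAntiOn_of_deriv_neg ordConnected_stem.convex (H.continuousOn_gain n) fun s hs => ?_
  obtain ⟨d, hd, h⟩ := H.exists_hasDerivAt_gain (interior_subset hs)
  rwa [h.deriv]

/-- A stem that is bounded below ends at a zero of the sum. -/
lemma exists_zero_of_bddBelow {n : ι} (hb : BddBelow (stem p β n)) :
    ∃ z ∉ range p, poleSum p β z = 0 ∧ z < p n ∧ Ioc z (p n) ⊆ stem p β n ∧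
      ∀ s ∈ stem p β n, z < s := by
  set z := sInf (stem p β n) with hz
  have hne : (stem p β n).Nonempty := ⟨_, pole_mem_stem n⟩
  have hsub : Ioc z (p n) ⊆ stem p β n := fun t ht => by
    obtain ⟨s, hs, hst⟩ := exists_lt_of_csInf_lt hne ht.1
    exact mem_stem_of_le hs hst.le ht.2
  have hzn : z < p n := by
    have h := (H.eventually_gain_mul_neg n).filter_mono (nhdsLT_le_nhdsNE (p n))
    obtain ⟨a, ha, hI⟩ := (mem_nhdsLT_iff_exists_Ico_subset).1 h
    refine (csInf_le hb ⟨?_, fun t ht htn => ?_⟩ : z ≤ a).trans_lt ha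
    · exact (le_of_lt ha)
    · obtain ⟨h1, h2⟩ := hI ⟨ht, htn⟩
      refine ⟨h1, ?_⟩
      have h3 := pos_of_mul_neg_left h2 (sub_neg.2 htn).le
      rwa [gain_of_notMem h1, neg_pos, inv_lt_zero] at h3
  have hright : ∀ᶠ t in 𝓝[>] z, t ∈ Ioo z (p n) := Ioo_mem_nhdsGT hzn
  have hneg : ∀ᶠ t in 𝓝[>] z, t ∉ range p ∧ poleSum p β t < 0 := by
    filter_upwards [hright] with t ht
    exact neg_of_mem_stem (hsub ⟨ht.1, ht.2.le⟩) ht.2.ne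
  have hzr : z ∉ range p := by
    rintro ⟨m, hm⟩
    have h := (H.eventually_gain_mul_neg m).filter_mono (nhdsGT_le_nhdsNE (p m))
    rw [hm] at h
    obtain ⟨t, ⟨-, h1⟩, ⟨h2, h3⟩, h4⟩ := (h.and (hneg.and hright)).exists
    rw [gain_of_notMem h2] at h1
    exact h1.not_gt (mul_pos (neg_pos.2 (inv_lt_zero.2 h3)) (sub_pos.2 h4.1))
  have hcont := (H.hasDerivAt hzr).continuousAt
  have hz0 : poleSum p β z = 0 := by
    refine le_antisymm (le_of_tendsto (hcont.tendsto.mono_left nhdsWithin_le_nhds)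
      (hneg.mono fun t ht => ht.2.le)) (not_lt.1 fun hlt => ?_)
    have h : ∀ᶠ t in 𝓝[≤] z, t ∉ range p ∧ poleSum p β t < 0 :=
      ((H.eventually_notMem hzr).and (hcont.eventually (gt_mem_nhds hlt))).filter_mono
        nhdsWithin_le_nhds
    obtain ⟨a, ha, hI⟩ := (mem_nhdsLE_iff_exists_Icc_subset).1 h
    refine (csInf_le hb (show a ∈ stem p β n from ⟨(le_of_lt ha).trans hzn.le,
      fun t ht htn => ?_⟩)).not_gt ha
    rcases le_or_gt t z with htz | htz
    · exact hI ⟨ht, htz⟩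
    · exact neg_of_mem_stem (hsub ⟨htz, htn.le⟩) htn.ne
  refine ⟨z, hzr, hz0, hzn, hsub, fun s hs => lt_of_le_of_ne (csInf_le hb hs) ?_⟩
  rintro rfl
  exact (neg_of_mem_stem hs hzn.ne).2.ne hz0

/-- The gain is unbounded on a stem: it blows up at the zero at the end of a bounded stem, while on an
unbounded stem the sum tends to `0` at `-∞`. -/
lemma exists_gain_ge (n : ι) {k : ℝ} (hk : 0 < k) : ∃ s ∈ stem p β n, k ≤ gain p β s := by
  have : Nonempty ι := ⟨n⟩
  suffices h : ∃ s ∈ stem p β n, s ≠ p n ∧ -k⁻¹ ≤ poleSum p β s by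
    obtain ⟨s, hs, hsn, h⟩ := h
    obtain ⟨h1, h2⟩ := neg_of_mem_stem hs hsn
    refine ⟨s, hs, ?_⟩
    rw [gain_of_notMem h1, neg_inv]
    exact (le_inv_comm₀ (neg_pos.2 h2) hk).1 (neg_le.1 h)
  by_cases hb : BddBelow (stem p β n)
  · obtain ⟨z, hzr, hz0, hzn, hsub, -⟩ := H.exists_zero_of_bddBelow hb
    have h := (H.hasDerivAt hzr).continuousAt.tendsto.mono_left (nhdsWithin_le_nhds (s := Ioi z))
    rw [hz0] at h
    have hk' : -k⁻¹ < 0 := neg_lt_zero.2 (inv_pos.2 hk)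
    obtain ⟨t, h1, h2⟩ := ((h.eventually (lt_mem_nhds hk')).and
      (Ioo_mem_nhdsGT hzn)).exists
    exact ⟨t, hsub ⟨h2.1, h2.2.le⟩, h2.2.ne, h1.le⟩
  · -- all poles are at least `p n`, so that the sum at `s` is at least `-∑ β / (p n - s)`
    have hall : ∀ s ≤ p n, s ∈ stem p β n := fun s hs => by
      rw [not_bddBelow_iff] at hb
      obtain ⟨t, ht, hts⟩ := hb s
      exact mem_stem_of_le ht hts.le hs
    have hle : ∀ m, p n ≤ p m := fun m => by
      by_contra h
      exact ((hall (p m) (not_le.1 h).le).2 _ le_rfl (not_le.1 h)).1 ⟨m, rfl⟩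
    have hM : 0 < ∑' m, β m := H.summable.tsum_pos (fun m => (H.pos m).le) n (H.pos n)
    set M := ∑' m, β m
    have hkM : 0 < k * M := mul_pos hk hM
    refine ⟨p n - k * M, hall _ (by linarith), by linarith, ?_⟩
    have h1 : ∀ m, -(β m / (p n - k * M - p m)) ≤ β m / (k * M) := fun m => by
      rw [← div_neg]
      have := hle m
      exact div_le_div_of_nonneg_left (H.pos m).le hkM (by linarith)
    have h2 := (H.summable_div (p n - k * M)).neg.tsum_le_tsum h1 (H.summable.div_const _)
    rw [tsum_neg, tsum_div_const, div_mul_cancel_right₀ hM.ne'] at h2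
    exact neg_le.1 h2

lemma surjOn_gain (n : ι) : SurjOn (gain p β) (stem p β n) (Ici 0) := by
  intro k hk
  rcases (mem_Ici.1 hk).eq_or_lt with rfl | hk
  · exact ⟨p n, pole_mem_stem n, gain_pole n⟩
  · obtain ⟨s, hs, hks⟩ := H.exists_gain_ge n hk
    exact ordConnected_stem.isPreconnected.intermediate_value (pole_mem_stem n) hs
      (H.continuousOn_gain n) ⟨by rw [gain_pole]; exact hk.le, hks⟩

end SeparatedPoles

/-! ### The branches -/

/-- The root-locus branch starting at the pole `p n`: the inverse of the gain on the stem. -/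
noncomputable def branch {ι : Type*} (p β : ι → ℝ) (n : ι) : ℝ → ℝ :=
  Function.invFunOn (gain p β) (stem p β n)

namespace SeparatedPoles

variable {ι : Type*} {p β : ι → ℝ} (H : SeparatedPoles p β)
include H

lemma branch_mem (n : ι) {k : ℝ} (hk : 0 ≤ k) : branch p β n k ∈ stem p β n :=
  Function.invFunOn_mem (H.surjOn_gain n hk)

lemma gain_branch (n : ι) {k : ℝ} (hk : 0 ≤ k) : gain p β (branch p β n k) = k :=
  Function.invFunOn_eq (H.surjOn_gain n hk)

lemma branch_gain {n : ι} {s : ℝ} (hs : s ∈ stem p β n) : branch p β n (gain p β s) = s :=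
  (H.strictAntiOn_gain n).injOn.leftInvOn_invFunOn hs

lemma branch_zero (n : ι) : branch p β n 0 = p n := by
  rw [← gain_pole (p := p) (β := β) n]
  exact H.branch_gain (pole_mem_stem n)

/-- The branch is continuous, as the inverse of a strictly monotone map between intervals. -/
lemma continuousOn_branch (n : ι) : ContinuousOn (branch p β n) (Ici 0) := by
  have hmono : StrictMonoOn (fun s => -gain p β s) (stem p β n) := fun a ha b hb hab =>
    neg_lt_neg (H.strictAntiOn_gain n ha hb hab)
  have himg : (fun s => -gain p β s) '' stem p β n = Iic 0 := by
    ext k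
    constructor
    · rintro ⟨s, hs, rfl⟩
      exact neg_nonpos.2 (gain_nonneg_of_mem_stem hs)
    · intro hk
      obtain ⟨s, hs, h⟩ := H.surjOn_gain n (show -k ∈ Ici 0 from neg_nonneg.2 (mem_Iic.1 hk))
      exact ⟨s, hs, by simp [h]⟩
  have : (stem p β n).OrdConnected := ordConnected_stem
  have : ((fun s => -gain p β s) '' stem p β n).OrdConnected := himg ▸ ordConnected_Iic
  let e := hmono.orderIso
  have hmem : ∀ k : Ici (0 : ℝ), -(k : ℝ) ∈ (fun s => -gain p β s) '' stem p β n := fun k => by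
    rw [himg]
    exact neg_nonpos.2 (mem_Ici.1 k.2)
  rw [continuousOn_iff_continuous_domRestrict]
  have heq : (Ici 0).domRestrict (branch p β n) = fun k : Ici (0 : ℝ) =>
      ((e.symm ⟨-(k : ℝ), hmem k⟩ : _) : ℝ) := by
    funext k
    have h1 : e ⟨branch p β n k, H.branch_mem n k.2⟩ = ⟨-(k : ℝ), hmem k⟩ :=
      Subtype.ext (congrArg Neg.neg (H.gain_branch n k.2))
    rw [← h1, OrderIso.symm_apply_apply]
    rfl
  rw [heq]
  have hc := e.symm.continuous
  exact continuous_subtype_val.comp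
    (hc.comp ((continuous_neg.comp continuous_subtype_val).subtype_mk hmem))

/-- For every gain `k ≥ 0`, the branches list the closed-loop points, each one exactly once. -/
lemma encard_branch (k : ℝ) (hk : 0 ≤ k) (s : ℝ) [Decidable (s ∈ closedLoopPoints p β k)] :
    {n | branch p β n k = s}.encard = if s ∈ closedLoopPoints p β k then 1 else 0 := by
  split_ifs with h
  · have hs : ∃ n, s ∈ stem p β n := by
      rcases h with ⟨_, n, rfl⟩ | ⟨hk', hs, h⟩
      · exact ⟨n, pole_mem_stem n⟩
      · exact H.exists_mem_stem s hs (poleSum_neg_of_mem (Or.inr ⟨hk', hs, h⟩) hk').2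
    obtain ⟨n, hn⟩ := hs
    rw [encard_eq_one]
    refine ⟨n, Subset.antisymm (fun m hm => ?_) ?_⟩
    · have h1 := H.branch_mem m hk
      rw [show branch p β m k = s from hm] at h1
      exact eq_of_mem_stem H.injective h1 hn
    · rintro _ rfl
      have h1 := H.branch_gain hn
      rwa [gain_eq_of_mem h] at h1
  · rw [encard_eq_zero]
    refine eq_empty_of_forall_notMem fun n hn => h ?_
    have h1 := mem_closedLoopPoints_gain (H.branch_mem n hk)
    rwa [H.gain_branch n hk, show branch p β n k = s from hn] at h1

/-! ### Arbitrary continuous selections of closed-loop points -/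

section Selection

variable {f : ℝ → ℝ} (hf : ContinuousOn f (Ici 0))
  (hmem : ∀ k, 0 ≤ k → f k ∈ closedLoopPoints p β k)
include hf hmem

/-- A continuous selection never leaves the stem it starts in: on the way from `p n` to `f k` it
meets no pole and no point where the sum is nonnegative. -/
lemma selection_mem_stem {n : ι} (h0 : f 0 = p n) {k : ℝ} (hk : 0 ≤ k) : f k ∈ stem p β n := by
  have hIcc : ContinuousOn f (Icc 0 k) := hf.mono fun _ h => h.1
  have hpos : ∀ l, 0 ≤ l → f l ≠ p n → f l ∉ range p ∧ poleSum p β (f l) < 0 := fun l hl hne =>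
    poleSum_neg_of_mem (hmem l hl) (lt_of_le_of_ne hl fun e => hne (by rw [← e, h0]))
  have hle : f k ≤ p n := by
    by_contra! hlt
    -- just to the right of a pole the gain is negative
    have h := (H.eventually_gain_mul_neg n).filter_mono (nhdsGT_le_nhdsNE (p n))
    obtain ⟨t, ⟨h1, h2⟩, h3⟩ := (h.and (Ioo_mem_nhdsGT hlt)).exists
    obtain ⟨l, hl, rfl⟩ := intermediate_value_Icc hk hIcc (show t ∈ Icc (f 0) (f k) from
      ⟨h0 ▸ h3.1.le, h3.2.le⟩)
    rw [gain_eq_of_mem (hmem l hl.1)] at h2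
    exact h2.not_ge (mul_nonneg hl.1 (sub_pos.2 h3.1).le)
  refine ⟨hle, fun t ht htn => ?_⟩
  obtain ⟨l, hl, rfl⟩ := intermediate_value_Icc' hk hIcc (show t ∈ Icc (f k) (f 0) from
    ⟨ht, h0 ▸ htn.le⟩)
  exact hpos l hl.1 htn.ne

lemma selection_strictAntiOn : StrictAntiOn f (Ici 0) := by
  obtain ⟨n, hn⟩ := exists_start hmem
  refine strictAntiOn_of_deriv_neg (convex_Ici 0) hf fun k hk => ?_
  rw [interior_Ici] at hk
  obtain ⟨d, hd, h⟩ := H.exists_hasDerivAt_gain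
    (H.selection_mem_stem hf hmem hn (le_of_lt hk))
  have h1 := (selection_hasDerivWithinAt hf hmem (le_of_lt hk) h hd.ne).hasDerivAt (Ici_mem_nhds hk)
  rw [h1.deriv]
  exact inv_lt_zero.2 hd

/-- If there is a pole further to the left, a selection converges to a zero of the sum. -/
lemma selection_tendsto {n m : ι} (h0 : f 0 = p n) (hm : p m < p n) :
    ∃ z ∉ range p, poleSum p β z = 0 ∧ Tendsto f atTop (𝓝 z) := by
  have hb : BddBelow (stem p β n) := ⟨p m, fun s hs => by
    by_contra! h
    exact (hs.2 (p m) h.le hm).1 ⟨m, rfl⟩⟩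
  obtain ⟨z, hzr, hz0, hzn, hsub, hlt⟩ := H.exists_zero_of_bddBelow hb
  refine ⟨z, hzr, hz0, tendsto_order.2 ⟨fun a ha => ?_, fun a ha => ?_⟩⟩
  · filter_upwards [eventually_ge_atTop 0] with k hk
    exact ha.trans (hlt _ (H.selection_mem_stem hf hmem h0 hk))
  · -- beyond the gain of a point `t < a` of the stem, the selection lies below `t`
    obtain ⟨t, hzt, hta⟩ := exists_between (lt_min ha hzn)
    have ht := hsub ⟨hzt, (hta.trans_le (min_le_right _ _)).le⟩
    filter_upwards [eventually_ge_atTop 0, eventually_gt_atTop (gain p β t)] with k hk hkt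
    have hs := H.selection_mem_stem hf hmem h0 hk
    by_contra! hak
    have htk : t ≤ f k := (hta.trans_le (min_le_left _ _)).le.trans hak
    have := (H.strictAntiOn_gain n).antitoneOn ht hs htk
    rw [gain_eq_of_mem (hmem k hk)] at this
    exact this.not_gt hkt

end Selection

/-! ### Interlacing -/

lemma interlace [Nonempty ι] : Interlace {z | z ∉ range p ∧ poleSum p β z = 0} (range p) where
  disjoint := Set.disjoint_left.2 fun _ hz => hz.1
  between := by
    rintro z ⟨hz, h0⟩
    have h1 : ∃ n, p n < z := by
      by_contra! h
      exact (H.poleSum_neg fun n => lt_of_le_of_ne (h n) fun e => hz ⟨n, e.symm⟩).ne h0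
    have h2 : ∃ n, z < p n := by
      by_contra! h
      exact (H.poleSum_pos fun n => lt_of_le_of_ne (h n) fun e => hz ⟨n, e⟩).ne' h0
    exact ⟨_, ⟨h1.choose, rfl⟩, _, ⟨h2.choose, rfl⟩, h1.choose_spec, h2.choose_spec⟩
  exists_left := by
    rintro _ ⟨m, rfl⟩ _ ⟨n, rfl⟩ h
    have hlow : ∀ s ∈ stem p β n, p m < s := fun s hs => by
      by_contra! h'
      exact (hs.2 (p m) h' h).1 ⟨m, rfl⟩
    obtain ⟨z, hzr, hz0, hzn, hsub, -⟩ :=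
      H.exists_zero_of_bddBelow ⟨p m, fun s hs => (hlow s hs).le⟩
    refine ⟨z, ⟨hzr, hz0⟩, lt_of_le_of_ne ?_ fun e => hzr ⟨m, e⟩, hzn⟩
    exact le_of_forall_gt_imp_ge_of_dense fun t ht => by
      rcases le_or_gt t (p n) with h' | h'
      · exact (hlow t (hsub ⟨ht, h'⟩)).le
      · exact (h.trans h').le
  exists_right := by
    rintro z ⟨hz, hz0⟩ w ⟨hw, hw0⟩ hzw
    by_contra! hno
    have h := H.strictAntiOn (D := Icc z w) ordConnected_Icc fun s hs hsr => by
      rcases hs.1.eq_or_lt with rfl | h1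
      · exact hz hsr
      · rcases (hno s hsr h1).antisymm hs.2 with rfl
        exact hw hsr
    exact (h (left_mem_Icc.2 hzw.le) (right_mem_Icc.2 hzw.le) hzw).ne (hw0.trans hz0.symm)

end SeparatedPoles

/-! ### Symmetric operators with discrete spectrum -/

section SymmetricOperators

open scoped InnerProductSpace

variable {Z : Type u} [NormedAddCommGroup Z] [InnerProductSpace ℂ Z] {A : Z →ₗ.[ℂ] Z}

lemma isFormalAdjoint_self [CompleteSpace Z] (hA : IsSelfAdjoint A) : A.IsFormalAdjoint A := by
  have h := LinearPMap.adjoint_isFormalAdjoint hA.dense_domain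
  rwa [LinearPMap.isSelfAdjoint_def.1 hA] at h

lemma IsEigenvalueOf.mem_spectrumOf {s : ℂ} (h : IsEigenvalueOf A s) : s ∈ spectrumOf A := by
  rintro ⟨R, hR⟩
  obtain ⟨x, hx, hxs⟩ := h
  have h1 := hR.2 x
  rw [hxs, sub_self, map_zero] at h1
  exact hx h1.symm

lemma resolventOf_spec {s : ℂ} (h : s ∈ resolventSetOf A) : IsResolventAt A s (resolventOf A s) := by
  have h' : ∃ R : Z →L[ℂ] Z, IsResolventAt A s R := h
  rw [resolventOf, dif_pos h']
  exact h'.choose_spec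

/-- If `(s - A) x` is orthogonal to `x`, then `s ‖x‖² = ⟪x, A x⟫`, which is real. This applies to
eigenvalues and to invariant zeros. -/
lemma im_eq_zero_of_inner_eq_zero (hA : A.IsFormalAdjoint A) {s : ℂ} {x : A.domain}
    (hx : (x : Z) ≠ 0) (h : ⟪(x : Z), s • (x : Z) - A x⟫_ℂ = 0) : s.im = 0 := by
  have h1 : s * ⟪(x : Z), x⟫_ℂ = ⟪(x : Z), A x⟫_ℂ := by
    rwa [inner_sub_right, inner_smul_right, sub_eq_zero] at h
  have h2 : (⟪(x : Z), A x⟫_ℂ).im = 0 := by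
    rw [← Complex.conj_eq_iff_im, inner_conj_symm, hA x x]
  have h3 : ⟪(x : Z), x⟫_ℂ = ((‖(x : Z)‖ ^ 2 : ℝ) : ℂ) := by
    rw [inner_self_eq_norm_sq_to_K]
    push_cast
    rfl
  rw [← h1, h3, Complex.im_mul_ofReal] at h2
  exact (mul_eq_zero.1 h2).resolve_right (by positivity)

lemma IsEigenvalueOf.im_eq_zero (hA : A.IsFormalAdjoint A) {s : ℂ} (h : IsEigenvalueOf A s) :
    s.im = 0 := by
  obtain ⟨x, hx, hxs⟩ := h
  exact im_eq_zero_of_inner_eq_zero hA hx (by rw [hxs, sub_self, inner_zero_right])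

lemma mem_kerPow_succ {s : ℂ} {m : ℕ} {z : Z} :
    z ∈ kerPow A s (m + 1) ↔ ∃ x : A.domain, (x : Z) = z ∧ s • (x : Z) - A x ∈ kerPow A s m := by
  simp only [kerPow, Submodule.mem_map, Submodule.mem_comap]
  exact ⟨fun ⟨x, h1, h2⟩ => ⟨x, h2, h1⟩, fun ⟨x, h1, h2⟩ => ⟨x, h2, h1⟩⟩

lemma mem_kerPow_one {s : ℂ} {z : Z} :
    z ∈ kerPow A s 1 ↔ ∃ x : A.domain, (x : Z) = z ∧ A x = s • (x : Z) := by
  rw [mem_kerPow_succ]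
  refine exists_congr fun x => and_congr_right fun _ => ?_
  rw [kerPow, Submodule.mem_bot, sub_eq_zero, eq_comm]

/-- A symmetric operator has no Jordan chains: its root spaces are eigenspaces. -/
lemma rootSpace_eq (hA : A.IsFormalAdjoint A) (s : ℂ) : rootSpace A s = kerPow A s 1 := by
  have h2 : ∀ z, z ∈ kerPow A s 2 → z ∈ kerPow A s 1 := by
    intro z hz
    obtain ⟨x, hx, h⟩ := mem_kerPow_succ.1 hz
    obtain ⟨y, hy, hys⟩ := mem_kerPow_one.1 h
    refine mem_kerPow_one.2 ⟨x, hx, ?_⟩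
    by_contra hne
    have hy0 : (y : Z) ≠ 0 := by
      rw [hy]
      exact fun e => hne (sub_eq_zero.1 e).symm
    have hreal : (starRingEnd ℂ) s = s :=
      Complex.conj_eq_iff_im.2 (IsEigenvalueOf.im_eq_zero hA ⟨y, hy0, hys⟩)
    have : ⟪(y : Z), y⟫_ℂ = 0 := by
      have h1 : ⟪s • (x : Z) - A x, (y : Z)⟫_ℂ = 0 := by
        rw [inner_sub_left, inner_smul_left, hreal, hA x y, hys, inner_smul_right, sub_self]
      rwa [← hy] at h1
    exact hy0 (inner_self_eq_zero.1 this)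
  have hm : ∀ m, kerPow A s m ≤ kerPow A s 1 := by
    intro m
    induction m with
    | zero => exact bot_le
    | succ m ih =>
      intro z hz
      obtain ⟨x, hx, h⟩ := mem_kerPow_succ.1 hz
      exact h2 z (mem_kerPow_succ.2 ⟨x, hx, ih h⟩)
  exact le_antisymm (iSup_le hm) (le_iSup (kerPow A s) 1)

open Classical in
/-- If a linear functional vanishes on no eigenvector, the eigenvalues of a symmetric operator are
algebraically simple. -/
lemma algMultiplicity_eq (hA : A.IsFormalAdjoint A) (s : ℂ) (C : Z →ₗ[ℂ] ℂ)
    (hC : ∀ x : A.domain, (x : Z) ≠ 0 → A x = s • (x : Z) → C x ≠ 0) :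
    algMultiplicity A s = if IsEigenvalueOf A s then 1 else 0 := by
  rw [algMultiplicity, rootSpace_eq hA]
  have hinj : ∀ y ∈ kerPow A s 1, C y = 0 → y = 0 := by
    intro y hy h0
    obtain ⟨x, rfl, hx⟩ := mem_kerPow_one.1 hy
    by_contra hne
    exact hC x hne hx h0
  split_ifs with h
  · obtain ⟨x, hx, hxs⟩ := h
    have hxm : (x : Z) ∈ kerPow A s 1 := mem_kerPow_one.2 ⟨x, rfl, hxs⟩
    have hCx := hC x hx hxs
    have : Module.rank ℂ (kerPow A s 1) = 1 := by
      rw [rank_submodule_eq_one_iff]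
      refine ⟨x, hxm, hx, fun y hy => Submodule.mem_span_singleton.2 ⟨C y / C x, ?_⟩⟩
      refine (sub_eq_zero.1 (hinj _ (Submodule.sub_mem _ hy (Submodule.smul_mem _ _ hxm)) ?_)).symm
      rw [map_sub, map_smul, smul_eq_mul, div_mul_cancel₀ _ hCx, sub_self]
    rw [this, map_one]
  · have : kerPow A s 1 = ⊥ := by
      rw [Submodule.eq_bot_iff]
      intro y hy
      obtain ⟨x, rfl, hx⟩ := mem_kerPow_one.1 hy
      by_contra hne
      exact h ⟨x, hne, hx⟩
    rw [this, rank_bot, map_zero]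

lemma HasDiscreteSpectrum.mem_iff (hd : HasDiscreteSpectrum A) {s : ℂ} :
    s ∈ spectrumOf A ↔ IsEigenvalueOf A s :=
  ⟨hd.eigenvalue s, IsEigenvalueOf.mem_spectrumOf⟩

lemma HasDiscreteSpectrum.separated (hd : HasDiscreteSpectrum A) (s : ℂ) :
    ∃ δ > 0, ∀ z ∈ spectrumOf A, z ≠ s → δ ≤ ‖s - z‖ := by
  have h := hd.no_accPt s
  rw [accPt_iff_frequently_nhdsNE, not_frequently, eventually_nhdsWithin_iff] at h
  obtain ⟨δ, hδ, h⟩ := Metric.eventually_nhds_iff.1 h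
  refine ⟨δ, hδ, fun z hz hzs => ?_⟩
  by_contra! hlt
  exact h (by rwa [dist_eq_norm, norm_sub_rev]) hzs hz

/-! ### Completeness of the eigenvectors -/

/-- Let `R` be a bounded self-adjoint operator whose nonzero spectral points are isolated. A vector
orthogonal to all eigenvectors with nonzero eigenvalue lies in the kernel of `R`: by the continuous
functional calculus, `R` is up to `ε` a finite combination of the projections `1_{t}(R)`, and these
map into eigenspaces. -/
lemma apply_eq_zero_of_orthogonal_eigenvectors [CompleteSpace Z] {R : Z →L[ℂ] Z}
    (hR : IsSelfAdjoint R)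
    (hiso : ∀ t ∈ spectrum ℝ R, t ≠ 0 → ∀ᶠ u in 𝓝 t, u ∈ spectrum ℝ R → u = t)
    {x : Z} (hx : ∀ t : ℝ, t ≠ 0 → ∀ y, R y = (t : ℂ) • y → ⟪y, x⟫_ℂ = 0) : R x = 0 := by
  classical
  set χ : ℝ → ℝ → ℝ := fun t u => if u = t then 1 else 0 with hχ
  have hχc : ∀ t ∈ spectrum ℝ R, t ≠ 0 → ContinuousOn (χ t) (spectrum ℝ R) := by
    intro t ht ht0 u hu
    have hconst : (χ t) =ᶠ[𝓝[spectrum ℝ R] u] fun _ => χ t u := by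
      by_cases hut : u = t
      · subst hut
        filter_upwards [(hiso u ht ht0).filter_mono nhdsWithin_le_nhds, self_mem_nhdsWithin]
          with v hv hvs
        rw [hv hvs]
      · filter_upwards [nhdsWithin_le_nhds (isOpen_ne.mem_nhds hut)] with v hv
        simp [hχ, hut, show v ≠ t from hv]
    exact continuousWithinAt_const.congr_of_eventuallyEq hconst rfl
  have hproj : ∀ t ∈ spectrum ℝ R, t ≠ 0 → cfc (χ t) R x = 0 := by
    intro t ht ht0
    set e := cfc (χ t) R with he
    have hRe : ∀ y, R (e y) = (t : ℂ) • e y := by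
      have h1 : R * e = t • e := by
        rw [he, ← cfc_const_mul t (χ t) R (hχc t ht ht0)]
        have h2 := cfc_mul (fun u => u) (χ t) R continuousOn_id (hχc t ht ht0)
        rw [cfc_id' ℝ R] at h2
        rw [← h2]
        congr 1
        funext u
        by_cases hut : u = t <;> simp [hχ, hut]
      intro y
      simpa using congrArg (fun T : Z →L[ℂ] Z => T y) h1
    have hsa : IsSelfAdjoint e := cfc_predicate (χ t) R
    have hsym := (ContinuousLinearMap.isSelfAdjoint_iff_isSymmetric.1 hsa) (e x) x
    rw [← inner_self_eq_zero (𝕜 := ℂ)]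
    exact hsym.symm.trans (hx t ht0 _ (hRe _))
  have hbound : ∀ ε > 0, ‖R x‖ ≤ ε * ‖x‖ := by
    intro ε hε
    set F := {t | t ∈ spectrum ℝ R ∧ ε ≤ |t|} with hF
    have hFfin : F.Finite := by
      by_contra hinf
      obtain ⟨t, ht, hacc⟩ := Set.Infinite.exists_accPt_of_subset_isCompact hinf
        ((spectrum.isCompact (𝕜 := ℝ) R).inter_right (isClosed_le continuous_const continuous_abs))
        (fun t ht => ht)
      have ht0 : t ≠ 0 := by
        rintro rfl
        have := ht.2
        simp only [mem_ofPred_eq, abs_zero] at this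
        exact this.not_gt hε
      rw [accPt_iff_frequently_nhdsNE] at hacc
      refine hacc ?_
      rw [eventually_nhdsWithin_iff]
      filter_upwards [hiso t ht.1 ht0] with u hu hut huF
      exact hut (hu huF.1)
    have hmem : ∀ t ∈ hFfin.toFinset, t ∈ spectrum ℝ R ∧ t ≠ 0 := by
      intro t ht
      obtain ⟨h1, h2⟩ := hFfin.mem_toFinset.1 ht
      refine ⟨h1, ?_⟩
      rintro rfl
      rw [abs_zero] at h2
      exact h2.not_gt hε
    have hc : ∀ t ∈ hFfin.toFinset, ContinuousOn (fun u => t * χ t u) (spectrum ℝ R) :=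
      fun t ht => continuousOn_const.mul (hχc t (hmem t ht).1 (hmem t ht).2)
    set g : ℝ → ℝ := fun u => ∑ t ∈ hFfin.toFinset, t * χ t u with hg
    have hgx : cfc g R x = 0 := by
      have : cfc g R = ∑ t ∈ hFfin.toFinset, t • cfc (χ t) R := by
        have hg' : g = ∑ t ∈ hFfin.toFinset, fun u => t * χ t u := by
          funext u
          rw [Finset.sum_apply]
        rw [hg', cfc_sum _ _ _ hc]
        exact Finset.sum_congr rfl fun t ht =>
          cfc_const_mul t (χ t) R (hχc t (hmem t ht).1 (hmem t ht).2)
      rw [this, sum_apply]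
      refine Finset.sum_eq_zero fun t ht => ?_
      rw [smul_apply, hproj t (hmem t ht).1 (hmem t ht).2, smul_zero]
    have hgc : ContinuousOn g (spectrum ℝ R) := continuousOn_finsetSum _ hc
    have hnorm : ‖R - cfc g R‖ ≤ ε := by
      have h1 : R - cfc g R = cfc (fun u => u - g u) R := by
        rw [cfc_sub (fun u => u) g R continuousOn_id hgc, cfc_id' ℝ R]
      rw [h1]
      refine norm_cfc_le hε.le fun u hu => ?_
      by_cases huF : u ∈ F
      · have : g u = u := by
          rw [hg]
          simp [hχ, huF]
        rw [this, sub_self, norm_zero]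
        exact hε.le
      · have : g u = 0 := by
          rw [hg]
          simp [hχ, huF]
        rw [this, sub_zero, Real.norm_eq_abs]
        by_contra! hlt
        exact huF ⟨hu, hlt.le⟩
    calc ‖R x‖ = ‖(R - cfc g R) x‖ := by rw [sub_apply, hgx, sub_zero]
      _ ≤ ‖R - cfc g R‖ * ‖x‖ := ContinuousLinearMap.le_opNorm _ _
      _ ≤ ε * ‖x‖ := by gcongr
  refine norm_le_zero_iff.1 (le_of_forall_pos_le_add fun ε hε => ?_)
  have h1 := hbound (ε / (‖x‖ + 1)) (by positivity)
  have h2 : ε / (‖x‖ + 1) * ‖x‖ ≤ ε := by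
    rw [div_mul_eq_mul_div, div_le_iff₀ (by positivity)]
    nlinarith [norm_nonneg x]
  linarith

/-- Spectral mapping for the resolvent: if `R = (μ - A)⁻¹` and `t ≠ 0` belongs to the spectrum of
`R`, then `μ - t⁻¹` belongs to the spectrum of `A`. -/
lemma IsResolventAt.sub_inv_mem_spectrumOf {μ : ℝ} {R : Z →L[ℂ] Z} (hR : IsResolventAt A μ R)
    {t : ℝ} (ht0 : t ≠ 0) (ht : t ∈ spectrum ℝ R) : ((μ - t⁻¹ : ℝ) : ℂ) ∈ spectrumOf A := by
  rintro ⟨R', hR'⟩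
  set c : ℂ := (t : ℂ)⁻¹ with hc
  have htc : (t : ℂ) * c = 1 := mul_inv_cancel₀ (by exact_mod_cast ht0)
  have hs : ((μ - t⁻¹ : ℝ) : ℂ) = μ - c := by push_cast; rfl
  rw [hs] at hR'
  -- the resolvent identity, in both orders
  have h1 : ∀ y, R' y - c • R' (R y) = R y := fun y => by
    obtain ⟨hd, h⟩ := hR.1 y
    have h' := hR'.2 ⟨R y, hd⟩
    have h3 : ((μ : ℂ) - c) • R y - A ⟨R y, hd⟩ = y - c • R y := by
      rw [sub_smul, sub_right_comm, h]
    rw [h3] at h'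
    rwa [map_sub, map_smul] at h'
  have h2 : ∀ y, R y + c • R (R' y) = R' y := fun y => by
    obtain ⟨hd, h⟩ := hR'.1 y
    have h' := hR.2 ⟨R' y, hd⟩
    have h3 : (μ : ℂ) • R' y - A ⟨R' y, hd⟩ = y + c • R' y := by
      nth_rw 3 [← h]
      rw [sub_smul]
      abel
    rw [h3] at h'
    rwa [map_add, map_smul] at h'
  have h4 : ∀ T : Z →L[ℂ] Z, ∀ y, (algebraMap ℝ (Z →L[ℂ] Z) t - T) y = (t : ℂ) • y - T y :=
    fun T y => by
      rw [sub_apply, Algebra.algebraMap_eq_smul_one, smul_apply, Complex.coe_smul]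
      rfl
  have h5 : ∀ y, (c • (1 : Z →L[ℂ] Z) + c ^ 2 • R') y = c • y + c ^ 2 • R' y := fun y => rfl
  have h6 : (t : ℂ) * c ^ 2 = c := by rw [pow_two, ← mul_assoc, htc, one_mul]
  refine ht (isUnit_iff_exists.2 ⟨c • 1 + c ^ 2 • R', ?_, ?_⟩)
  · ext y
    change (algebraMap ℝ (Z →L[ℂ] Z) t - R) ((c • (1 : Z →L[ℂ] Z) + c ^ 2 • R') y) = y
    have h7 := congrArg (fun v => c • v) (h2 y)
    simp only [smul_add, smul_smul, ← pow_two] at h7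
    rw [h4, h5, map_add, map_smul, map_smul, smul_add, smul_smul, smul_smul, htc, h6, one_smul,
      h7]
    abel
  · ext y
    change (c • (1 : Z →L[ℂ] Z) + c ^ 2 • R') ((algebraMap ℝ (Z →L[ℂ] Z) t - R) y) = y
    have h7 := congrArg (fun v => c • v) (h1 y)
    simp only [smul_sub, smul_smul, ← pow_two] at h7
    rw [h4, h5, map_sub, map_smul, smul_sub, smul_sub, smul_smul, smul_smul, mul_comm c,
      mul_comm (c ^ 2), htc, h6, one_smul, h7]
    abel

lemma IsResolventAt.isSelfAdjoint [CompleteSpace Z] (hA : A.IsFormalAdjoint A) {μ : ℝ}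
    {R : Z →L[ℂ] Z} (hR : IsResolventAt A μ R) : IsSelfAdjoint R := by
  rw [ContinuousLinearMap.isSelfAdjoint_iff_isSymmetric]
  intro y z
  obtain ⟨hy, hy'⟩ := hR.1 y
  obtain ⟨hz, hz'⟩ := hR.1 z
  have h := hA ⟨R y, hy⟩ ⟨R z, hz⟩
  change ⟪R y, z⟫_ℂ = ⟪y, R z⟫_ℂ
  conv_lhs => rw [← hz']
  conv_rhs => rw [← hy']
  rw [inner_sub_right, inner_sub_left, inner_smul_left, inner_smul_right, Complex.conj_ofReal]
  simp only at h
  rw [h]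

/-- The eigenvectors of a self-adjoint operator with discrete spectrum are complete. -/
lemma eq_zero_of_orthogonal_eigenvectors [CompleteSpace Z] (hA : A.IsFormalAdjoint A)
    (hd : HasDiscreteSpectrum A) {x : Z}
    (hx : ∀ (s : ℂ) (y : A.domain), A y = s • (y : Z) → ⟪(y : Z), x⟫_ℂ = 0) : x = 0 := by
  obtain ⟨μ, R, hR⟩ : ∃ μ : ℝ, (μ : ℂ) ∈ resolventSetOf A := by
    obtain ⟨δ, hδ, h⟩ := hd.separated 0
    refine ⟨δ / 2, ?_⟩
    by_contra hmem
    have h1 := h _ hmem (by exact_mod_cast (half_pos hδ).ne')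
    rw [zero_sub, norm_neg, Complex.norm_real, Real.norm_of_nonneg (half_pos hδ).le] at h1
    linarith
  suffices h0 : R x = 0 by
    obtain ⟨hm, h⟩ := hR.1 x
    have h1 : (⟨R x, hm⟩ : A.domain) = 0 := Subtype.ext h0
    rw [h1, h0, smul_zero, A.map_zero, sub_zero] at h
    exact h.symm
  refine apply_eq_zero_of_orthogonal_eigenvectors (hR.isSelfAdjoint hA) (fun t ht ht0 => ?_)
    fun t ht0 y hy => ?_
  · obtain ⟨δ, hδ, h⟩ := hd.separated ((μ - t⁻¹ : ℝ) : ℂ)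
    have hcont : ∀ᶠ u in 𝓝 t, |t⁻¹ - u⁻¹| < δ := by
      have h1 : ContinuousAt (fun u : ℝ => |t⁻¹ - u⁻¹|) t :=
        (continuousAt_const.sub (continuousAt_inv₀ ht0)).abs
      exact h1.eventually (gt_mem_nhds (by simpa using hδ))
    filter_upwards [hcont, isOpen_ne.mem_nhds ht0] with u hu hu0 hus
    by_contra hut
    have h1 := h _ (hR.sub_inv_mem_spectrumOf hu0 hus) fun e => hut ?_
    · rw [← Complex.ofReal_sub, Complex.norm_real, Real.norm_eq_abs, abs_sub_comm] at h1
      refine h1.not_gt (lt_of_eq_of_lt ?_ hu)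
      congr 1
      ring
    · have := Complex.ofReal_injective e
      exact inv_injective (by linarith)
  · have htc : (t : ℂ) ≠ 0 := by exact_mod_cast ht0
    obtain ⟨hm, h⟩ := hR.1 y
    have hym : y ∈ A.domain := by
      have : y = (t : ℂ)⁻¹ • R y := by rw [hy, inv_smul_smul₀ htc]
      rw [this]
      exact A.domain.smul_mem _ hm
    have hsub : (⟨R y, hm⟩ : A.domain) = (t : ℂ) • ⟨y, hym⟩ := Subtype.ext hy
    refine hx (μ - (t : ℂ)⁻¹) ⟨y, hym⟩ ?_
    rw [hsub, A.map_smul, hy] at h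
    change A ⟨y, hym⟩ = (μ - (t : ℂ)⁻¹) • y
    rw [sub_smul, eq_sub_iff_add_eq, ← eq_sub_iff_add_eq']
    rw [smul_comm, ← smul_sub] at h
    have h1 := congrArg (fun v => (t : ℂ)⁻¹ • v) h
    simp only [inv_smul_smul₀ htc] at h1
    exact h1.symm

/-! ### Generators are bounded above on their real eigenvalues -/

/-- On an eigenvector the semigroup acts as `exp (t r)`, so a real eigenvalue `r` of the generator
satisfies `exp r ≤ ‖T 1‖`. -/
lemma IsGenerator.eigenvalue_le {T : ℝ≥0 → Z →L[ℂ] Z} (hT : IsC0Semigroup T)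
    (hgen : IsGenerator A T) {r : ℝ} (hr : IsEigenvalueOf A r) : r ≤ ‖T 1‖ := by
  obtain ⟨x, hx, hxr⟩ := hr
  have hlim := (hgen x (A x)).1 (A.mem_graph x)
  rw [hxr] at hlim
  set w : ℝ → Z := fun t => T t.toNNReal x with hw
  have hwc : Continuous w := (hT.continuous x).comp continuous_real_toNNReal
  have hderiv : ∀ t, 0 ≤ t → HasDerivWithinAt w ((r : ℂ) • w t) (Ici t) t := by
    intro t ht
    rw [hasDerivWithinAt_iff_tendsto_slope, Ici_sdiff_left]
    have h1 : Tendsto (fun t' : ℝ => (t' - t).toNNReal) (𝓝[>] t) (𝓝[>] 0) := by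
      refine tendsto_nhdsWithin_iff.2 ⟨?_, ?_⟩
      · have : Continuous fun t' : ℝ => (t' - t).toNNReal :=
          continuous_real_toNNReal.comp (continuous_sub_right t)
        have h2 := this.tendsto t
        simp only [sub_self, Real.toNNReal_zero] at h2
        exact h2.mono_left nhdsWithin_le_nhds
      · filter_upwards [self_mem_nhdsWithin] with t' ht'
        exact Real.toNNReal_pos.2 (sub_pos.2 ht')
    have h2 := ((T t.toNNReal).continuous.tendsto _).comp (hlim.comp h1)
    rw [map_smul] at h2
    refine h2.congr' ?_
    filter_upwards [self_mem_nhdsWithin] with t' ht'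
    have hpos : 0 ≤ t' - t := (sub_pos.2 ht').le
    have hadd : t'.toNNReal = t.toNNReal + (t' - t).toNNReal := by
      rw [← Real.toNNReal_add ht hpos, add_sub_cancel]
    simp only [Function.comp, hw, slope_def_module]
    rw [hadd, hT.map_add, ContinuousLinearMap.comp_apply, Real.coe_toNNReal _ hpos, map_smul,
      map_sub, ← Complex.ofReal_inv, Complex.coe_smul]
  have hec : Continuous fun t => Real.exp (-(r * t)) := by fun_prop
  have hconst := constant_of_has_deriv_right_zero (a := 0) (b := 1)
    (f := fun t => Real.exp (-(r * t)) • w t) (hec.smul hwc).continuousOn fun t ht => by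
      have he : HasDerivAt (fun t => Real.exp (-(r * t))) (Real.exp (-(r * t)) * -r) t := by
        have := ((hasDerivAt_id t).const_mul r).fun_neg.exp
        simpa using this
      have := he.hasDerivWithinAt.fun_smul (hderiv t ht.1)
      refine this.congr_deriv ?_
      rw [Complex.coe_smul, smul_smul, ← add_smul]
      simp
  have h1 := hconst 1 (right_mem_Icc.2 zero_le_one)
  simp only [hw, mul_one, mul_zero, neg_zero, Real.exp_zero, one_smul, Real.toNNReal_zero,
    Real.toNNReal_one, hT.map_zero, ContinuousLinearMap.id_apply] at h1
  have h2 : ‖(x : Z)‖ ≤ Real.exp (-r) * (‖T 1‖ * ‖(x : Z)‖) := by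
    conv_lhs => rw [← h1]
    rw [norm_smul, Real.norm_of_nonneg (Real.exp_pos _).le]
    gcongr
    exact ContinuousLinearMap.le_opNorm _ _
  have hxpos : 0 < ‖(x : Z)‖ := norm_pos_iff.2 hx
  have h3 : Real.exp r ≤ ‖T 1‖ := by
    rw [Real.exp_neg, ← mul_assoc, ← one_mul ‖(x : Z)‖, ← mul_assoc, mul_one] at h2
    have := le_of_mul_le_mul_right h2 hxpos
    rwa [inv_mul_eq_div, one_le_div (Real.exp_pos r)] at this
  have := Real.add_one_le_exp r
  linarith

end SymmetricOperators

/-! ### Collocated systems in modal coordinates -/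

namespace SISOSystem

open scoped InnerProductSpace

variable {Z : Type u} [NormedAddCommGroup Z] [InnerProductSpace ℂ Z] {S : SISOSystem Z}

/-- `φ` is an orthonormal basis of eigenvectors of the symmetric operator `S.A`, one for each
spectral point, the observation is `C x = ⟪b, x⟫` with `b = B 1`, and it sees every mode `φ l`. -/
structure IsModalBasis (S : SISOSystem Z) (φ : HilbertBasis (spectrumOf S.A) ℂ Z) : Prop where
  symmetric : S.A.IsFormalAdjoint S.A
  discrete : HasDiscreteSpectrum S.A
  output : ∀ x, S.C x = ⟪S.B 1, x⟫_ℂ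
  observable : ∀ x : S.A.domain, (x : Z) ≠ 0 → ∀ s : ℂ, S.A x = s • (x : Z) → S.C x ≠ 0
  eigenvector : ∀ l, ∃ h : φ l ∈ S.A.domain, S.A ⟨φ l, h⟩ = (l : ℂ) • φ l

/-- The eigenvalues of `A` as real numbers. -/
noncomputable def modalPole (S : SISOSystem Z) (l : spectrumOf S.A) : ℝ := (l : ℂ).re

/-- The squared modulus of the input vector `B 1` in the mode `φ l`. -/
noncomputable def modalWeight (S : SISOSystem Z) (φ : HilbertBasis (spectrumOf S.A) ℂ Z)
    (l : spectrumOf S.A) : ℝ := ‖⟪S.B 1, φ l⟫_ℂ‖ ^ 2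

lemma B_apply (S : SISOSystem Z) (w : ℂ) : S.B w = w • S.B 1 := by
  rw [← map_smul, smul_eq_mul, mul_one]

lemma closedLoop_apply (S : SISOSystem Z) (k : ℝ) (x : S.A.domain) :
    S.closedLoop k x = S.A x - ((k : ℂ) * S.C x) • S.B 1 := by
  have : S.closedLoop k x = S.A x - (k : ℂ) • S.B (S.C x) := rfl
  rw [this, S.B_apply, smul_smul]

/-- The closed-loop eigenvalue equation as an equation `(s - A) x = w b` with scalar `w`. -/
lemma closedLoop_eigen_iff {k : ℝ} {s : ℂ} {x : S.A.domain} :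
    S.closedLoop k x = s • (x : Z) ↔ s • (x : Z) - S.A x = (-((k : ℂ) * S.C x)) • S.B 1 := by
  rw [closedLoop_apply, neg_smul, sub_eq_iff_eq_add, sub_eq_iff_eq_add, neg_add_eq_sub,
    eq_sub_iff_add_eq, eq_comm]

/-- A minimal collocated self-adjoint system has a modal basis: by minimality the functional `B*`
vanishes on no eigenvector, so all eigenvalues are simple, and the eigenvectors are complete. -/
lemma exists_isModalBasis [CompleteSpace Z] (hd : HasDiscreteSpectrum S.A) (hmin : S.IsMinimal)
    (hcol : S.IsCollocatedSelfAdjoint) :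
    ∃ φ : HilbertBasis (spectrumOf S.A) ℂ Z, S.IsModalBasis φ := by
  have hA := isFormalAdjoint_self hcol.1
  have hC : ∀ x, S.C x = ⟪S.B 1, x⟫_ℂ := fun x => by
    rw [hcol.2, ← ContinuousLinearMap.adjoint_inner_right]
    simp
  have hobs : ∀ x : S.A.domain, (x : Z) ≠ 0 → ∀ s : ℂ, S.A x = s • (x : Z) → S.C x ≠ 0 := by
    intro x hx s hs h0
    have hmem : s ∈ S.invariantZeros ∩ spectrumOf S.A :=
      ⟨⟨x, 0, hx, by rw [hs, map_zero, sub_self, sub_zero], h0⟩,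
        IsEigenvalueOf.mem_spectrumOf ⟨x, hx, hs⟩⟩
    rw [hmin] at hmem
    exact hmem
  have hev : ∀ l : spectrumOf S.A, ∃ x : S.A.domain, ‖(x : Z)‖ = 1 ∧ S.A x = (l : ℂ) • (x : Z) := by
    intro l
    obtain ⟨x, hx, h⟩ := hd.eigenvalue l l.2
    refine ⟨((‖(x : Z)‖⁻¹ : ℝ) : ℂ) • x, ?_, ?_⟩
    · rw [Submodule.coe_smul, norm_smul, Complex.norm_real, norm_inv, norm_norm,
        inv_mul_cancel₀ (norm_ne_zero_iff.2 hx)]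
    · rw [S.A.map_smul, h, Submodule.coe_smul, smul_comm]
  choose e he1 he using hev
  have hreal : ∀ l : spectrumOf S.A, (starRingEnd ℂ) (l : ℂ) = l := fun l =>
    Complex.conj_eq_iff_im.2 ((hd.eigenvalue l l.2).im_eq_zero hA)
  have horth : Orthonormal ℂ fun l => (e l : Z) := by
    refine ⟨he1, fun l m hlm => ?_⟩
    have h := hA (e l) (e m)
    rw [he, he, inner_smul_left, inner_smul_right, hreal] at h
    by_contra h0
    exact hlm (Subtype.ext (mul_right_cancel₀ h0 h))
  have hcompl : (Submodule.span ℂ (range fun l => (e l : Z)))ᗮ = ⊥ := by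
    rw [Submodule.eq_bot_iff]
    intro x hx
    rw [Submodule.mem_orthogonal] at hx
    refine eq_zero_of_orthogonal_eigenvectors hA hd fun s y hy => ?_
    by_cases hy0 : (y : Z) = 0
    · rw [hy0, inner_zero_left]
    · -- eigenvectors for one eigenvalue are proportional, as `C` vanishes on none of them
      have hs : s ∈ spectrumOf S.A := IsEigenvalueOf.mem_spectrumOf ⟨y, hy0, hy⟩
      set l : spectrumOf S.A := ⟨s, hs⟩
      have hCe : S.C (e l) ≠ 0 :=
        hobs (e l) (fun h => by simpa [h] using he1 l) l (he l)
      have hdiff : ((y - (S.C y / S.C (e l)) • e l : S.A.domain) : Z) = 0 := by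
        by_contra hne
        refine hobs _ hne s ?_ ?_
        · rw [S.A.map_sub, S.A.map_smul, hy, he, Submodule.coe_sub, Submodule.coe_smul, smul_sub,
            smul_comm s]
        · rw [Submodule.coe_sub, Submodule.coe_smul, map_sub, map_smul, smul_eq_mul,
            div_mul_cancel₀ _ hCe, sub_self]
      rw [Submodule.coe_sub, Submodule.coe_smul, sub_eq_zero] at hdiff
      rw [hdiff]
      exact hx _ (Submodule.smul_mem _ _ (Submodule.subset_span ⟨l, rfl⟩))
  refine ⟨HilbertBasis.mkOfOrthogonalEqBot horth hcompl, hA, hd, hC, hobs, fun l => ?_⟩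
  rw [HilbertBasis.coe_mkOfOrthogonalEqBot]
  exact ⟨(e l).2, he l⟩

lemma isFormalAdjoint_closedLoop (hA : S.A.IsFormalAdjoint S.A)
    (hC : ∀ x, S.C x = ⟪S.B 1, x⟫_ℂ) (k : ℝ) :
    (S.closedLoop k).IsFormalAdjoint (S.closedLoop k) := by
  suffices h : ∀ x y : S.A.domain,
      ⟪S.closedLoop k x, (y : Z)⟫_ℂ = ⟪(x : Z), S.closedLoop k y⟫_ℂ from h
  intro x y
  have hx : ⟪(x : Z), S.B 1⟫_ℂ = (starRingEnd ℂ) (S.C x) := by rw [hC, inner_conj_symm]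
  rw [closedLoop_apply, closedLoop_apply, inner_sub_left, inner_sub_right, hA x y,
    inner_smul_left, inner_smul_right, ← hC y, hx, map_mul, Complex.conj_ofReal]
  ring

lemma IsRootLocus.continuousOn_re {ι : Type v} {f : ι → ℝ → ℂ} (hf : S.IsRootLocus f) (n : ι) :
    ContinuousOn (fun k => (f n k).re) (Ici 0) :=
  Complex.continuous_re.comp_continuousOn (hf.continuousOn n)

namespace IsModalBasis

variable {φ : HilbertBasis (spectrumOf S.A) ℂ Z} (H : S.IsModalBasis φ)
include H

lemma ofReal_modalPole (l : spectrumOf S.A) : (S.modalPole l : ℂ) = l :=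
  Complex.ext rfl ((H.discrete.eigenvalue l l.2).im_eq_zero H.symmetric).symm

lemma mem_range_modalPole {r : ℝ} : r ∈ range S.modalPole ↔ (r : ℂ) ∈ spectrumOf S.A := by
  constructor
  · rintro ⟨l, rfl⟩
    rw [H.ofReal_modalPole]
    exact l.2
  · exact fun h => ⟨⟨r, h⟩, Complex.ofReal_re r⟩

lemma nonempty : Nonempty (spectrumOf S.A) := H.discrete.nonempty.to_subtype

lemma separatedPoles : SeparatedPoles S.modalPole (S.modalWeight φ) where
  injective l m h := by
    have := congrArg Complex.ofReal h
    rw [H.ofReal_modalPole, H.ofReal_modalPole] at this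
    exact Subtype.ext this
  separated s := by
    obtain ⟨δ, hδ, h⟩ := H.discrete.separated s
    refine ⟨δ, hδ, fun l hl => ?_⟩
    have h1 := h l l.2 fun e => hl (Complex.ofReal_injective ((H.ofReal_modalPole l).trans e))
    rwa [← H.ofReal_modalPole, ← Complex.ofReal_sub, Complex.norm_real] at h1
  pos l := by
    obtain ⟨hm, h⟩ := H.eigenvector l
    refine pow_pos (norm_pos_iff.2 ?_) 2
    rw [← H.output]
    exact H.observable ⟨φ l, hm⟩ (φ.orthonormal.ne_zero l) l h
  summable := by
    refine (φ.summable_inner_mul_inner (S.B 1) (S.B 1)).norm.congr fun l => ?_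
    rw [norm_mul, norm_inner_symm (φ l), modalWeight, pow_two]

/-- The modal coordinates of a solution of `(r - A) x = w b`. -/
lemma coord {r : ℝ} {w : ℂ} {x : S.A.domain} (h : (r : ℂ) • (x : Z) - S.A x = w • S.B 1)
    (l : spectrumOf S.A) :
    ((r - S.modalPole l : ℝ) : ℂ) * ⟪φ l, (x : Z)⟫_ℂ = w * ⟪φ l, S.B 1⟫_ℂ := by
  obtain ⟨hm, he⟩ := H.eigenvector l
  have h1 := H.symmetric ⟨φ l, hm⟩ x
  rw [he, inner_smul_left, ← H.ofReal_modalPole, Complex.conj_ofReal] at h1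
  rw [← inner_smul_right _ _ w, ← h, inner_sub_right, inner_smul_right, ← h1]
  push_cast
  ring

lemma coord_eq {r : ℝ} (hr : r ∉ range S.modalPole) {w : ℂ} {x : S.A.domain}
    (h : (r : ℂ) • (x : Z) - S.A x = w • S.B 1) (l : spectrumOf S.A) :
    ⟪φ l, (x : Z)⟫_ℂ = w * ⟪φ l, S.B 1⟫_ℂ / ((r - S.modalPole l : ℝ) : ℂ) := by
  have hne : ((r - S.modalPole l : ℝ) : ℂ) ≠ 0 :=
    Complex.ofReal_ne_zero.2 (sub_ne_zero.2 fun e => hr ⟨l, e.symm⟩)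
  rw [eq_div_iff hne, mul_comm, H.coord h]

/-- The output of a solution of `(r - A) x = w b` is `w` times the sum of simple poles. -/
lemma output_eq {r : ℝ} (hr : r ∉ range S.modalPole) {w : ℂ} {x : S.A.domain}
    (h : (r : ℂ) • (x : Z) - S.A x = w • S.B 1) :
    S.C x = w * (poleSum S.modalPole (S.modalWeight φ) r : ℂ) := by
  rw [H.output, ← φ.tsum_inner_mul_inner, poleSum, Complex.ofReal_tsum, ← tsum_mul_left]
  refine tsum_congr fun l => ?_
  rw [H.coord_eq hr h, ← inner_conj_symm (φ l), modalWeight, Complex.ofReal_div, Complex.ofReal_pow,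
    ← Complex.mul_conj']
  ring

/-- The squared norm of a solution of `(r - A) x = w b` is `-|w|²` times the derivative of the sum of
simple poles. -/
lemma norm_sq_eq {r : ℝ} (hr : r ∉ range S.modalPole) {w : ℂ} {x : S.A.domain}
    (h : (r : ℂ) • (x : Z) - S.A x = w • S.B 1) :
    ‖(x : Z)‖ ^ 2 = ‖w‖ ^ 2 * ∑' l, S.modalWeight φ l / (r - S.modalPole l) ^ 2 := by
  have h1 : ((‖(x : Z)‖ ^ 2 : ℝ) : ℂ) = ⟪(x : Z), x⟫_ℂ := by
    rw [inner_self_eq_norm_sq_to_K]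
    push_cast
    rfl
  rw [← Complex.ofReal_inj, h1, ← φ.tsum_inner_mul_inner, ← tsum_mul_left, Complex.ofReal_tsum]
  refine tsum_congr fun l => ?_
  rw [← inner_conj_symm (x : Z), mul_comm, Complex.mul_conj', H.coord_eq hr h, norm_div, norm_mul,
    Complex.norm_real, norm_inner_symm, modalWeight, ← Complex.ofReal_pow]
  congr 1
  rw [div_pow, mul_pow, Real.norm_eq_abs, sq_abs, mul_div_assoc]

/-- Off the spectrum, `(r - A) x = b` has a solution. -/
lemma exists_solution {r : ℝ} (hr : r ∉ range S.modalPole) :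
    ∃ x : S.A.domain, (r : ℂ) • (x : Z) - S.A x = S.B 1 := by
  rw [H.mem_range_modalPole, spectrumOf, notMem_compl_iff] at hr
  obtain ⟨R, hR⟩ := hr
  obtain ⟨hm, h⟩ := hR.1 (S.B 1)
  exact ⟨⟨R (S.B 1), hm⟩, h⟩

lemma B_ne_zero : S.B 1 ≠ 0 := by
  intro h
  obtain ⟨l⟩ := H.nonempty
  have := H.separatedPoles.pos l
  rw [modalWeight, h, inner_zero_left, norm_zero] at this
  norm_num at this

lemma solution_ne_zero {r : ℝ} {x : S.A.domain}
    (h : (r : ℂ) • (x : Z) - S.A x = S.B 1) : (x : Z) ≠ 0 := by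
  intro h0
  have : x = 0 := Subtype.ext h0
  subst this
  rw [S.A.map_zero, Submodule.coe_zero, smul_zero, sub_zero] at h
  exact H.B_ne_zero h.symm

/-- Eigenvectors of the closed loop are seen by the output: otherwise they would be eigenvectors
of `A` itself. -/
lemma output_ne_zero {k : ℝ} {s : ℂ} {x : S.A.domain} (hx : (x : Z) ≠ 0)
    (h : S.closedLoop k x = s • (x : Z)) : S.C x ≠ 0 := by
  intro h0
  refine H.observable x hx s ?_ h0
  rw [← h, closedLoop_apply, h0, mul_zero, zero_smul, sub_zero]

/-- At an eigenvalue, `b` is not in the range of `r - A`, having a nonzero component along the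
eigenvector. -/
lemma notMem_range_of_solution {r : ℝ} {w : ℂ} (hw : w ≠ 0) {x : S.A.domain}
    (h : (r : ℂ) • (x : Z) - S.A x = w • S.B 1) : r ∉ range S.modalPole := by
  rintro ⟨l, rfl⟩
  have h1 := H.coord h l
  rw [sub_self, Complex.ofReal_zero, zero_mul] at h1
  have h2 := H.separatedPoles.pos l
  rw [modalWeight, norm_inner_symm, (mul_eq_zero.1 h1.symm).resolve_left hw, norm_zero] at h2
  norm_num at h2

lemma mem_closedLoopPoints_of_eigen {k : ℝ} (hk : 0 ≤ k) {r : ℝ} {x : S.A.domain}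
    (hx : (x : Z) ≠ 0) (h : S.closedLoop k x = (r : ℂ) • (x : Z)) :
    r ∈ closedLoopPoints S.modalPole (S.modalWeight φ) k := by
  have hC := H.output_ne_zero hx h
  rcases hk.eq_or_lt with rfl | hk
  · refine Or.inl ⟨rfl, H.mem_range_modalPole.2 (IsEigenvalueOf.mem_spectrumOf ⟨x, hx, ?_⟩)⟩
    rw [← h, closedLoop_apply, Complex.ofReal_zero, zero_mul, zero_smul, sub_zero]
  · have h1 := closedLoop_eigen_iff.1 h
    have hw : -((k : ℂ) * S.C x) ≠ 0 :=
      neg_ne_zero.2 (mul_ne_zero (Complex.ofReal_ne_zero.2 hk.ne') hC)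
    have hr := H.notMem_range_of_solution hw h1
    refine Or.inr ⟨hk, hr, ?_⟩
    have h2 := H.output_eq hr h1
    have h3 : S.C x * ((k * poleSum S.modalPole (S.modalWeight φ) r + 1 : ℝ) : ℂ) = 0 := by
      push_cast
      linear_combination h2
    have h4 := Complex.ofReal_eq_zero.1 ((mul_eq_zero.1 h3).resolve_left hC)
    linarith

/-- For `k ≥ 0`, the closed-loop eigenvalues are the real solutions of `1 + k G(r) = 0`, where `G`
is the sum of simple poles given by the modal data. -/
lemma isEigenvalueOf_closedLoop_iff {k : ℝ} (hk : 0 ≤ k) {s : ℂ} :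
    IsEigenvalueOf (S.closedLoop k) s ↔
      ∃ r ∈ closedLoopPoints S.modalPole (S.modalWeight φ) k, (r : ℂ) = s := by
  constructor
  · intro hs
    have him := hs.im_eq_zero (isFormalAdjoint_closedLoop H.symmetric H.output k)
    have hre : (s.re : ℂ) = s := Complex.ext rfl him.symm
    obtain ⟨x, hx, h⟩ := hs
    rw [← hre] at h
    exact ⟨s.re, H.mem_closedLoopPoints_of_eigen hk hx h, hre⟩
  · rintro ⟨r, ⟨rfl, l, rfl⟩ | ⟨hk', hr, h⟩, rfl⟩
    · obtain ⟨hm, he⟩ := H.eigenvector l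
      refine ⟨(⟨φ l, hm⟩ : S.A.domain), φ.orthonormal.ne_zero l, ?_⟩
      rw [closedLoop_apply, he, Complex.ofReal_zero, zero_mul, zero_smul, sub_zero,
        H.ofReal_modalPole]
    · obtain ⟨x, hx⟩ := H.exists_solution hr
      refine ⟨x, H.solution_ne_zero hx, closedLoop_eigen_iff.2 ?_⟩
      rw [← one_smul ℂ (S.B 1)] at hx
      rw [hx, H.output_eq hr hx, one_mul, ← Complex.ofReal_mul, h]
      simp

open Classical in
lemma algMultiplicity_closedLoop {k : ℝ} (hk : 0 ≤ k) (s : ℂ) :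
    algMultiplicity (S.closedLoop k) s =
      if ∃ r ∈ closedLoopPoints S.modalPole (S.modalWeight φ) k, (r : ℂ) = s then 1 else 0 := by
  rw [algMultiplicity_eq (isFormalAdjoint_closedLoop H.symmetric H.output k) s S.C
    fun x hx h => H.output_ne_zero hx h]
  exact if_congr (H.isEigenvalueOf_closedLoop_iff hk) rfl rfl

lemma isRootLocus_branch :
    S.IsRootLocus fun l k => (branch S.modalPole (S.modalWeight φ) l k : ℂ) where
  continuousOn l :=
    Complex.continuous_ofReal.comp_continuousOn (H.separatedPoles.continuousOn_branch l)
  encard_eq k hk s := by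
    classical
    rw [H.algMultiplicity_closedLoop hk]
    by_cases hs : (s.re : ℂ) = s
    · have h1 : ∀ r : ℝ, (r : ℂ) = s ↔ r = s.re := fun r => by
        rw [← Complex.ofReal_inj, hs]
      simp only [h1, exists_eq_right]
      exact H.separatedPoles.encard_branch k hk s.re
    · have h1 : ∀ r : ℝ, (r : ℂ) ≠ s := fun r e => hs (by rw [← e, Complex.ofReal_re])
      simp [h1]

/-! ### Zeros -/

lemma mem_invariantZeros_iff {r : ℝ} : (r : ℂ) ∈ S.invariantZeros ↔
    r ∉ range S.modalPole ∧ poleSum S.modalPole (S.modalWeight φ) r = 0 := by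
  constructor
  · rintro ⟨x, w, hx, h, h0⟩
    rw [sub_eq_zero, S.B_apply] at h
    have hw : w ≠ 0 := by
      rintro rfl
      rw [zero_smul, sub_eq_zero] at h
      exact H.observable x hx r h.symm h0
    have hr := H.notMem_range_of_solution hw h
    refine ⟨hr, ?_⟩
    rw [H.output_eq hr h] at h0
    exact Complex.ofReal_eq_zero.1 ((mul_eq_zero.1 h0).resolve_left hw)
  · rintro ⟨hr, h0⟩
    obtain ⟨x, hx⟩ := H.exists_solution hr
    refine ⟨x, 1, H.solution_ne_zero hx, by rw [hx, sub_self], ?_⟩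
    rw [← one_smul ℂ (S.B 1)] at hx
    rw [H.output_eq hr hx, h0, Complex.ofReal_zero, mul_zero]

lemma im_eq_zero_of_mem_invariantZeros {s : ℂ} (hs : s ∈ S.invariantZeros) : s.im = 0 := by
  obtain ⟨x, w, hx, h, h0⟩ := hs
  refine im_eq_zero_of_inner_eq_zero H.symmetric hx ?_
  rw [sub_eq_zero.1 h, S.B_apply, inner_smul_right, ← inner_conj_symm, ← H.output, h0, map_zero,
    mul_zero]

lemma transmissionZeros_eq (hmin : S.IsMinimal) : S.transmissionZeros = S.invariantZeros := by
  ext s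
  constructor
  · rintro ⟨hs, h0⟩
    obtain ⟨hm, h⟩ := (resolventOf_spec hs).1 (S.B 1)
    refine ⟨⟨_, hm⟩, 1, fun e => ?_, sub_eq_zero.2 h, h0⟩
    have e' : (⟨_, hm⟩ : S.A.domain) = 0 := Subtype.ext e
    rw [e', show resolventOf S.A s (S.B 1) = 0 from e, S.A.map_zero, smul_zero, sub_zero] at h
    exact H.B_ne_zero h.symm
  · intro hs
    have hres : s ∈ resolventSetOf S.A := by
      by_contra hσ
      have : s ∈ S.invariantZeros ∩ spectrumOf S.A := ⟨hs, hσ⟩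
      rw [hmin] at this
      exact this
    obtain ⟨x, w, hx, h, h0⟩ := hs
    rw [sub_eq_zero, S.B_apply] at h
    have h1 := (resolventOf_spec hres).2 x
    rw [h, map_smul] at h1
    have hw : w ≠ 0 := by
      rintro rfl
      rw [zero_smul] at h1
      exact hx h1.symm
    rw [← h1, map_smul, smul_eq_mul] at h0
    exact ⟨hres, (mul_eq_zero.1 h0).resolve_left hw⟩

/-! ### Arbitrary root-locus families -/

/-- At the eigenvalue of a normalized closed-loop eigenvector `x`, the derivative of the gain is
`-1 / |C x|²`. -/
lemma hasDerivAt_gain {k : ℝ} (hk : 0 ≤ k) {r : ℝ} {x : S.A.domain} (hx : ‖(x : Z)‖ = 1)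
    (h : S.closedLoop k x = (r : ℂ) • (x : Z)) :
    HasDerivAt (gain S.modalPole (S.modalWeight φ)) (-(‖S.C x‖ ^ 2)⁻¹) r := by
  have hx0 : (x : Z) ≠ 0 := fun e => by simp [e] at hx
  have hw := closedLoop_eigen_iff.1 h
  rcases H.mem_closedLoopPoints_of_eigen hk hx0 h with ⟨rfl, l, rfl⟩ | ⟨hk', hr, hG⟩
  · have hco : ∀ m, m ≠ l → ⟪φ m, (x : Z)⟫_ℂ = 0 := fun m hm => by
      have h1 := H.coord hw m
      rw [Complex.ofReal_zero, zero_mul, neg_zero, zero_mul] at h1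
      refine (mul_eq_zero.1 h1).resolve_left (Complex.ofReal_ne_zero.2 (sub_ne_zero.2 ?_))
      exact fun e => hm (H.separatedPoles.injective e.symm)
    have hxl : (x : Z) = ⟪φ l, (x : Z)⟫_ℂ • φ l := by
      have h1 := φ.hasSum_repr x
      simp only [φ.repr_apply_apply] at h1
      exact h1.unique (hasSum_single l fun m hm => by rw [hco m hm, zero_smul])
    have hn : ‖⟪φ l, (x : Z)⟫_ℂ‖ = 1 := by
      have h1 := congrArg norm hxl
      rwa [norm_smul, φ.orthonormal.1 l, mul_one, hx, eq_comm] at h1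
    have hCx : ‖S.C x‖ ^ 2 = S.modalWeight φ l := by
      rw [H.output, hxl, inner_smul_right, norm_mul, hn, one_mul, modalWeight]
    rw [hCx]
    exact H.separatedPoles.hasDerivAt_gain_pole l
  · have hG0 : poleSum S.modalPole (S.modalWeight φ) r ≠ 0 := by
      intro e
      rw [e, mul_zero] at hG
      norm_num at hG
    refine (H.separatedPoles.hasDerivAt_gain hr hG0).congr_deriv ?_
    have h1 := H.norm_sq_eq hr hw
    rw [hx, norm_neg, norm_mul, Complex.norm_real, mul_pow, Real.norm_eq_abs, sq_abs, one_pow] at h1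
    have hC : ‖S.C x‖ ^ 2 ≠ 0 := pow_ne_zero 2 (norm_ne_zero_iff.2 (H.output_ne_zero hx0 h))
    have hG2 : k ^ 2 * poleSum S.modalPole (S.modalWeight φ) r ^ 2 = 1 := by
      rw [← mul_pow, hG]
      norm_num
    rw [neg_div, neg_inj, div_eq_iff (pow_ne_zero 2 hG0), inv_mul_eq_div, eq_div_iff hC]
    have hk2 : k ^ 2 ≠ 0 := pow_ne_zero 2 hk'.ne'
    refine mul_left_cancel₀ hk2 ?_
    rw [hG2, h1]
    ring

variable {ι : Type v} {f : ι → ℝ → ℂ}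

/-- Every value of a root-locus family is real and a closed-loop point, since it is listed with
nonzero multiplicity. -/
lemma branch_value (hf : S.IsRootLocus f) (n : ι) {k : ℝ} (hk : 0 ≤ k) :
    ((f n k).re : ℂ) = f n k ∧
      (f n k).re ∈ closedLoopPoints S.modalPole (S.modalWeight φ) k := by
  classical
  have h := hf.encard_eq k hk (f n k)
  rw [H.algMultiplicity_closedLoop hk] at h
  have hne : {m | f m k = f n k}.encard ≠ 0 := encard_ne_zero.2 ⟨n, rfl⟩
  split_ifs at h with hr
  · obtain ⟨r, hr, e⟩ := hr
    rw [← e, Complex.ofReal_re]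
    exact ⟨rfl, hr⟩
  · exact (hne h).elim

lemma hasDerivWithinAt (hf : S.IsRootLocus f) (n : ι) {k : ℝ} (hk : 0 ≤ k)
    {x : S.A.domain} (hx : ‖(x : Z)‖ = 1) (h : S.closedLoop k x = f n k • (x : Z)) :
    HasDerivWithinAt (f n) (-((‖S.C x‖ ^ 2 : ℝ) : ℂ)) (Ici 0) k := by
  have hx0 : (x : Z) ≠ 0 := fun e => by simp [e] at hx
  have hC := norm_ne_zero_iff.2 (H.output_ne_zero hx0 h)
  rw [← (H.branch_value hf n hk).1] at h
  have h1 := selection_hasDerivWithinAt (hf.continuousOn_re n)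
    (fun l hl => (H.branch_value hf n hl).2) hk (H.hasDerivAt_gain hk hx h)
    (neg_ne_zero.2 (inv_ne_zero (pow_ne_zero 2 hC)))
  rw [inv_neg, inv_inv] at h1
  have h2 := h1.ofReal_comp
  rw [Complex.ofReal_neg] at h2
  exact h2.congr (fun l hl => (H.branch_value hf n hl).1.symm) (H.branch_value hf n hk).1.symm

/-- In infinite dimensions, a spectrum that is bounded above is unbounded below: otherwise it
would be finite, having no accumulation point. -/
lemma exists_modalPole_lt (hinf : ¬ FiniteDimensional ℂ Z) {M : ℝ} (hM : ∀ l, S.modalPole l ≤ M)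
    (a : ℝ) : ∃ l, S.modalPole l < a := by
  by_contra! hlow
  have hfin : (spectrumOf S.A).Finite := by
    by_contra hinf'
    have himg : Complex.ofReal '' Icc a M ⊇ spectrumOf S.A := fun s hs =>
      ⟨_, ⟨hlow ⟨s, hs⟩, hM _⟩, H.ofReal_modalPole ⟨s, hs⟩⟩
    obtain ⟨s, -, hs⟩ := Set.Infinite.exists_accPt_of_subset_isCompact hinf'
      (isCompact_Icc.image Complex.continuous_ofReal) himg
    exact H.discrete.no_accPt s hs
  have := hfin.fintype
  exact hinf φ.toOrthonormalBasis.toBasis.finiteDimensional_of_finite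

end IsModalBasis

end SISOSystem

theorem mainTheorem2 {Z : Type u} [NormedAddCommGroup Z] [InnerProductSpace ℂ Z] [CompleteSpace Z]
    (S : SISOSystem Z) (hS : S.StandingAssumptions) (hmin : S.IsMinimal)
    (hcol : S.IsCollocatedSelfAdjoint) :
    -- the root locus exists, with one branch starting at each eigenvalue
    (∃ f : spectrumOf S.A → ℝ → ℂ, S.IsRootLocus f ∧ ∀ l, f l 0 = l) ∧
    -- eigenvalues and zeros (of both kinds) are real and interlace
    (∀ s ∈ spectrumOf S.A, s.im = 0) ∧
    S.transmissionZeros = S.invariantZeros ∧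
    (∀ s ∈ S.invariantZeros, s.im = 0) ∧
    Interlace {r : ℝ | (r : ℂ) ∈ S.invariantZeros} {r : ℝ | (r : ℂ) ∈ spectrumOf S.A} ∧
    -- the behaviour of every branch
    ∀ {ι : Type v} (f : ι → ℝ → ℂ), S.IsRootLocus f → ∀ n : ι,
      (∀ k : ℝ, 0 ≤ k → (f n k).im = 0) ∧
      (∀ k : ℝ, 0 ≤ k → ∀ x : (S.closedLoop k).domain, ‖(x : Z)‖ = 1 →
        S.closedLoop k x = f n k • (x : Z) →
        HasDerivWithinAt (f n) (-((‖ContinuousLinearMap.adjoint S.B (x : Z)‖ ^ 2 : ℝ) : ℂ))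
          (Ici 0) k) ∧
      StrictAntiOn (fun k => (f n k).re) (Ici 0) ∧
      (¬ FiniteDimensional ℂ Z →
        (∃ z ∈ S.invariantZeros, Tendsto (f n) atTop (𝓝 z)) ∧
        ¬ Tendsto (fun k => ‖f n k‖) atTop atTop) := by
  obtain ⟨φ, H⟩ := SISOSystem.exists_isModalBasis hS.discrete hmin hcol
  have hP := H.separatedPoles
  have hne := H.nonempty
  refine ⟨⟨_, H.isRootLocus_branch, fun l => ?_⟩,
    fun s hs => (hS.discrete.eigenvalue s hs).im_eq_zero H.symmetric,
    H.transmissionZeros_eq hmin, fun s hs => H.im_eq_zero_of_mem_invariantZeros hs, ?_,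
    fun f hf n => ⟨fun k hk => ?_, fun k hk x hx h => ?_, ?_, fun hinf => ?_⟩⟩
  · rw [hP.branch_zero, H.ofReal_modalPole]
  · have h1 : {r : ℝ | (r : ℂ) ∈ S.invariantZeros} =
        {z | z ∉ range S.modalPole ∧ poleSum S.modalPole (S.modalWeight φ) z = 0} :=
      ext fun r => H.mem_invariantZeros_iff
    have h2 : {r : ℝ | (r : ℂ) ∈ spectrumOf S.A} = range S.modalPole :=
      ext fun r => H.mem_range_modalPole.symm
    rw [h1, h2]
    exact hP.interlace
  · rw [← (H.branch_value hf n hk).1, Complex.ofReal_im]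
  · rw [← hcol.2]
    exact H.hasDerivWithinAt hf n hk hx h
  · exact hP.selection_strictAntiOn (hf.continuousOn_re n) fun k hk => (H.branch_value hf n hk).2
  · have hmem := fun k hk => (H.branch_value hf n (k := k) hk).2
    obtain ⟨T, hT, hgen⟩ := hS.generates
    obtain ⟨l, hl⟩ := exists_start hmem
    obtain ⟨m, hm⟩ := H.exists_modalPole_lt hinf (fun m => hgen.eigenvalue_le hT
      (H.discrete.mem_iff.1 (H.mem_range_modalPole.1 ⟨m, rfl⟩))) (S.modalPole l)
    obtain ⟨z, hzr, hz0, hz⟩ := hP.selection_tendsto (hf.continuousOn_re n) hmem hl hm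
    have hlim : Tendsto (f n) atTop (𝓝 (z : ℂ)) := by
      refine ((Complex.continuous_ofReal.tendsto z).comp hz).congr' ?_
      filter_upwards [eventually_ge_atTop 0] with k hk
      exact (H.branch_value hf n hk).1
    exact ⟨⟨z, H.mem_invariantZeros_iff.2 ⟨hzr, hz0⟩, hlim⟩,
      not_tendsto_atTop_of_tendsto_nhds hlim.norm⟩
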